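/- Let $N\ge 1$, $s\in(0,1)$, $p\in(1,\infty)$. Write $a^{q}:=|a|^{q-1}a$ for $a\in\mathbb R$, $q>0$, $a_+=\max\{a,0\}$, $B_r$ for the open ball of radius $r$ centred at $0$, and $\mathbb R^N_+=\{x: x\cdot e_N>0\}$. **Definitions.** For $U\subseteq\mathbb R^N$ open let $$\|u\|_{W^{s,p}(U)}=\|u\|_{L^p(U)}+\Big(\int_{U\times U}\frac{|u(x)-u(y)|^p}{|x-y|^{N+ps}}\,dx\,dy\Big)^{1/p},$$ let $W^{s,p}_0(\Omega)=\{\varphi\in W^{s,p}(\mathbb R^N):\varphi=0\text{ a.e. in }\Omega^c\}$ and let $W^{-s,p'}(\Omega)$ be its dual. For bounded $\Omega$, $\widetilde W^{s,p}(\Omega)$ is the set of all $u\in L^p_{\rm loc}(\mathbb R^N)$ such that, for some open $U\supseteq\overline\Omega$, $$\|u\|_{W^{s,p}(U)}+\int_{\mathbb R^N}\frac{|u(x)|^{p-1}}{(1+|x|)^{N+ps}}\,dx<\infty.$$ For unbounded $\Omega$, $\widetilde W^{s,p}_{\rm loc}(\Omega)$ is the set of all $u\in L^p_{\rm loc}(\mathbb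 R^N)$ with $u\in\widetilde W^{s,p}(\Omega')$ for every bounded $\Omega'\subseteq\Omega$. For a bounded open $\Omega$, $u$ is a weak solution of $(-\Delta)_p^su=f$ in $\Omega$ if $u\in\widetilde W^{s,p}(\Omega)$, the functional $\varphi\mapsto\int_\Omega f\varphi\,dx$ belongs to $W^{-s,p'}(\Omega)$ and, for all $\varphi\in W^{s,p}_0(\Omega)$, $$\int_{\mathbb R^N\times\mathbb R^N}\frac{(u(x)-u(y))^{p-1}(\varphi(x)-\varphi(y))}{|x-y|^{N+ps}}\,dx\,dy=\int_\Omega f\varphi\,dx,$$ the integrals being absolutely convergent. For an unbounded open $\Omega$, $u\in\widetilde W^{s,p}_{\rm loc}(\Omega)$ is a weak solution in $\Omega$ if it is one in every bounded open $\Omega'\subseteq\Omega$. A $C^{1,1}$ diffeomorphism of $\mathbb R^N$ is a bijection $\Phi$ of $\mathbb R^N$ such that $\Phi$ and $\Phi^{-1}$ are continuously differentiable with globally Lipschitz derivatives; then $D^2\Phi$ exists almost everywhere and is essentially bounded. Norms of derivatives are taken in $L^\infty(\mathbb R^N)$. **Lemma (change of variables).** For all $M,M'\ge 0$ and $r>0$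 there is a constant $C$, depending only on $N,p,s,M,M',r$, such that the following holds for every $C^{1,1}$ diffeomorphism $\Phi$ of $\mathbb R^N$ with $\Phi(x)=x$ for all $x\notin B_r$, $\|D\Phi\|_\infty\le M$ and $\|D\Phi^{-1}\|_\infty\le M'$. The function $$v(x)=\big(\Phi^{-1}(x)\cdot e_N\big)_+^s$$ belongs to $\widetilde W^{s,p}_{\rm loc}(\mathbb R^N)$, and there is $f\in L^\infty(\Phi(\mathbb R^N_+))$ such that $v$ is a weak solution of $(-\Delta)_p^sv=f$ in $\Phi(\mathbb R^N_+)$ and $$\|f\|_{L^\infty(\Phi(\mathbb R^N_+))}\le C\,\|D^2\Phi\|_\infty.$$ -/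

import Mathlib

open MeasureTheory
open scoped ENNReal NNReal

namespace FracPLap

/-- Euclidean space `ℝ^N`. -/
abbrev E (N : ℕ) : Type := EuclideanSpace ℝ (Fin N)

/-- The signed power `a ↦ |a|^(q-1) a`. -/
noncomputable def spow (a q : ℝ) : ℝ := |a| ^ (q - 1) * a

/-- The density `|u(x) - u(y)|^p / |x - y|^(N + p s)` of the Gagliardo seminorm. -/
noncomputable def gagliardo {N : ℕ} (s p : ℝ) (u : E N → ℝ) (z : E N × E N) : ℝ :=
  |u z.1 - u z.2| ^ p / ‖z.1 - z.2‖ ^ ((N : ℝ) + p * s)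

/-- The norm `‖u‖_{W^{s,p}(U)}`, with values in `[0, ∞]`. -/
noncomputable def wNorm {N : ℕ} (s p : ℝ) (U : Set (E N)) (u : E N → ℝ) : ℝ≥0∞ :=
  eLpNorm u (ENNReal.ofReal p) (volume.restrict U) +
    (∫⁻ z in U ×ˢ U, ENNReal.ofReal (gagliardo s p u z)) ^ (1 / p)

/-- `φ ∈ W^{s,p}_0(Ω)`: `φ ∈ W^{s,p}(ℝ^N)` and `φ = 0` (almost everywhere) in `Ω^c`. -/
def MemW0 {N : ℕ} (s p : ℝ) (Ω : Set (E N)) (φ : E N → ℝ) : Prop :=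
  AEStronglyMeasurable φ volume ∧ wNorm s p Set.univ φ < ∞ ∧ ∀ᵐ x, x ∉ Ω → φ x = 0

/-- `u ∈ L^p_loc(ℝ^N)`. -/
def MemLpLoc {N : ℕ} (p : ℝ) (u : E N → ℝ) : Prop :=
  ∀ K : Set (E N), IsCompact K → MemLp u (ENNReal.ofReal p) (volume.restrict K)

/-- `u ∈ W̃^{s,p}(Ω)`, for bounded `Ω`: `u ∈ L^p_loc(ℝ^N)`, there is an open `U ⋑ Ω` with
`‖u‖_{W^{s,p}(U)} < ∞`, and `∫ |u|^(p-1) / (1 + |x|)^(N + p s) dx < ∞`. -/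
def MemWTilde {N : ℕ} (s p : ℝ) (Ω : Set (E N)) (u : E N → ℝ) : Prop :=
  MemLpLoc p u ∧
    ∃ U : Set (E N), IsOpen U ∧ closure Ω ⊆ U ∧
      wNorm s p U u +
        ∫⁻ x : E N, ENNReal.ofReal (|u x| ^ (p - 1) / (1 + ‖x‖) ^ ((N : ℝ) + p * s)) < ∞

/-- `u ∈ W̃^{s,p}_loc(Ω)`, for unbounded `Ω`. -/
def MemWTildeLoc {N : ℕ} (s p : ℝ) (Ω : Set (E N)) (u : E N → ℝ) : Prop :=
  MemLpLoc p u ∧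
    ∀ Ω' : Set (E N), Bornology.IsBounded Ω' → Ω' ⊆ Ω → MemWTilde s p Ω' u

/-- The function `f` belongs to the dual `W^{-s,p'}(Ω)` of `W^{s,p}_0(Ω)`: the pairing
`φ ↦ ∫_Ω f φ` is a well-defined bounded functional on `W^{s,p}_0(Ω)`. -/
def MemDual {N : ℕ} (s p : ℝ) (Ω : Set (E N)) (f : E N → ℝ) : Prop :=
  (∀ φ : E N → ℝ, MemW0 s p Ω φ → IntegrableOn (fun x => f x * φ x) Ω) ∧
    ∃ K : ℝ≥0, ∀ φ : E N → ℝ, MemW0 s p Ω φ →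
      ‖∫ x in Ω, f x * φ x‖ₑ ≤ K * wNorm s p Set.univ φ

/-- The integrand `(u(x) - u(y))^(p-1) (φ(x) - φ(y)) / |x - y|^(N + p s)`
of the weak formulation. -/
noncomputable def weakForm {N : ℕ} (s p : ℝ) (u φ : E N → ℝ) (z : E N × E N) : ℝ :=
  spow (u z.1 - u z.2) (p - 1) * (φ z.1 - φ z.2) / ‖z.1 - z.2‖ ^ ((N : ℝ) + p * s)

/-- `u` is a weak solution of `(-Δ)_p^s u = f` in the bounded open set `Ω`. The integrability
of the integrand is recorded, so that its Bochner integral is the genuine one. -/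
def IsWeakSolBounded {N : ℕ} (s p : ℝ) (Ω : Set (E N)) (u f : E N → ℝ) : Prop :=
  MemWTilde s p Ω u ∧ MemDual s p Ω f ∧
    ∀ φ : E N → ℝ, MemW0 s p Ω φ →
      Integrable (weakForm s p u φ) ∧
        ∫ z : E N × E N, weakForm s p u φ z = ∫ x in Ω, f x * φ x

/-- `u` is a weak solution of `(-Δ)_p^s u = f` in the unbounded open set `Ω`: it is one in every
bounded open subset. -/
def IsWeakSol {N : ℕ} (s p : ℝ) (Ω : Set (E N)) (u f : E N → ℝ) : Prop :=
  MemWTildeLoc s p Ω u ∧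
    ∀ Ω' : Set (E N), IsOpen Ω' → Bornology.IsBounded Ω' → Ω' ⊆ Ω →
      IsWeakSolBounded s p Ω' u f

/-- Maps of class `C^{1,1}`: continuously differentiable with globally Lipschitz derivative. -/
def IsC11 {N : ℕ} (g : E N → E N) : Prop :=
  ContDiff ℝ 1 g ∧ ∃ L : ℝ≥0, LipschitzWith L (fderiv ℝ g)

/-- A bijection of `ℝ^N` that is a `C^{1,1}` diffeomorphism. -/
def IsC11Diffeo {N : ℕ} (Φ : E N ≃ E N) : Prop :=
  IsC11 Φ ∧ IsC11 Φ.symm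

/-- The norm `‖Dg‖_∞`. -/
noncomputable def supD {N : ℕ} (g : E N → E N) : ℝ≥0∞ :=
  eLpNorm (fderiv ℝ g) ∞ volume

/-- The norm `‖D²g‖_∞`. For `g` of class `C^{1,1}` the second derivative exists almost everywhere;
`fderiv` is `0` on the exceptional null set, which the essential supremum ignores. -/
noncomputable def supD2 {N : ℕ} (g : E N → E N) : ℝ≥0∞ :=
  eLpNorm (fderiv ℝ (fderiv ℝ g)) ∞ volume

/-- The last coordinate `x_N = x · e_N`, for `N ≥ 1`. -/
def lastCoord {N : ℕ} (hN : 1 ≤ N) (x : E N) : ℝ :=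
  x ⟨N - 1, Nat.sub_one_lt_of_lt hN⟩

/-- The open half-space `ℝ^N_+ = {x | x_N > 0}`. -/
def halfSpace {N : ℕ} (hN : 1 ≤ N) : Set (E N) :=
  {x | 0 < lastCoord hN x}

end FracPLap

namespace FracPLap

open Set Filter Topology Module

/-! Write x = Φ(w), y = Φ(z), and let a, b be the last coordinates of w, z. In these variables the
kernel is |det DΦ(z)| |Φ(w) - Φ(z)|^(-N-ps). Freezing the derivative at w replaces it by |det DΦ(w)|
|DΦ(w)(w - z)|^(-N-ps), even and homogeneous in w - z. Integrating out the other N - 1 coordinates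
leaves a multiple of |a - b|^(-1-ps), and in one dimension b_+^s is annihilated by the operator at
every a > 0. Hence only the error `kernelDiff` contributes, and f is twice its integral (`residual`)
composed with Φ⁻¹. Since DΦ is Lipschitz with constant K = ‖D²Φ‖_∞ and equals the identity away from
B_r, the error is smaller than the kernel by a factor K min(|w - z|, 8r). Together with the Hölder
bound |w - z|^(s(p-1)) on the power of the increment this leaves K min(|w - z|, 8r) |w - z|^(-N-s),
whose integral is a constant times K.

The frozen integral need not converge absolutely, so the diagonal is cut out first, by `offDiag l`.
This truncation is symmetric, so the weak form can be unfolded into an operator acting on v. It is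
also scale invariant and sees only a and b, so the frozen part is explicit: a bounded constant times
a^(-s) κ(l), where κ(l) = (1 - l^s)^p (1 - l)^(-ps) / (ps) (`integral_truncInt_sub`,
`exists_truncOp_bounds`). Here 0 ≤ κ ≤ 1/(ps), and κ(l) → 0 as l → 1.

The limit l → 1 is taken by dominated convergence on both sides. The truncated weak form is
dominated by the full one (`IsTame.integrable_weakForm`). The operator paired with φ is dominated by
a constant times |φ| (K + a^(-s)), which is integrable by a fractional Hardy inequality for
functions vanishing outside the domain (`IsTame.integrable_abs_rpow_mul_lastCoord_rpow`). -/

/-! ### The profile b_+^s and signed powers -/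

/-- The profile `b ↦ b_+^s`. -/
noncomputable def posPow (s b : ℝ) : ℝ := (max b 0) ^ s

/-- A scale invariant symmetric truncation that removes a neighbourhood of the diagonal of the
positive quadrant. -/
def offDiag (l a b : ℝ) : Prop := b ≤ l * a ∨ a ≤ l * b

lemma offDiag_symm {l a b : ℝ} : offDiag l a b ↔ offDiag l b a := or_comm

lemma posPow_of_nonpos {s b : ℝ} (hs : 0 < s) (hb : b ≤ 0) : posPow s b = 0 := by
  rw [posPow, max_eq_right hb, Real.zero_rpow hs.ne']

lemma posPow_of_nonneg {s b : ℝ} (hb : 0 ≤ b) : posPow s b = b ^ s := by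
  rw [posPow, max_eq_left hb]

lemma posPow_mono {s : ℝ} (hs : 0 ≤ s) : Monotone (posPow s) := fun a b h => by
  unfold posPow
  gcongr

lemma continuous_posPow {s : ℝ} (hs : 0 ≤ s) : Continuous (posPow s) := by
  unfold posPow
  exact (continuous_id.max continuous_const).rpow_const fun _ => Or.inr hs

lemma posPow_mul {s a b : ℝ} (ha : 0 ≤ a) : posPow s (a * b) = a ^ s * posPow s b := by
  unfold posPow
  rw [← Real.mul_rpow ha (le_max_right _ _), mul_max_of_nonneg _ _ ha, mul_zero]

lemma abs_posPow_sub_le {s : ℝ} (hs0 : 0 < s) (hs1 : s < 1) (a b : ℝ) :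
    |posPow s a - posPow s b| ≤ |a - b| ^ s := by
  wlog h : b ≤ a generalizing a b
  · rw [abs_sub_comm, abs_sub_comm a b]
    exact this b a (le_of_not_ge h)
  rw [abs_of_nonneg (sub_nonneg.2 (posPow_mono hs0.le h)), abs_of_nonneg (sub_nonneg.2 h)]
  have h1 : max a 0 ≤ (a - b) + max b 0 := by
    rcases le_total a 0 with h2 | h2
    · rw [max_eq_right h2]
      have := le_max_right b 0
      linarith
    · rw [max_eq_left h2]
      have := le_max_left b 0
      linarith
  have h2 : posPow s a ≤ (a - b) ^ s + posPow s b := by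
    unfold posPow
    exact (Real.rpow_le_rpow (le_max_right _ _) h1 hs0.le).trans
      (Real.rpow_add_le_add_rpow (sub_nonneg.2 h) (le_max_right _ _) hs0.le hs1.le)
  linarith

lemma abs_one_sub_posPow_le {s : ℝ} (hs0 : 0 < s) (hs1 : s < 1) (t : ℝ) :
    |1 - posPow s t| ≤ |1 - t| := by
  rcases le_total t 0 with h | h
  · rw [posPow_of_nonpos hs0 h, sub_zero, abs_one, abs_of_nonneg (by linarith)]
    linarith
  · rw [posPow_of_nonneg h]
    rcases le_total t 1 with h1 | h1
    · have h2 : t ≤ t ^ s := by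
        rcases h.eq_or_lt with rfl | h
        · simp [hs0.ne']
        · simpa using Real.rpow_le_rpow_of_exponent_ge h h1 hs1.le
      have h3 : t ^ s ≤ 1 := Real.rpow_le_one h h1 hs0.le
      rw [abs_of_nonneg (by linarith), abs_of_nonneg (by linarith)]
      linarith
    · have h2 : t ^ s ≤ t := by
        simpa using Real.rpow_le_rpow_of_exponent_le h1 hs1.le
      have h3 : 1 ≤ t ^ s := Real.one_le_rpow h1 hs0.le
      rw [abs_of_nonpos (by linarith), abs_of_nonpos (by linarith)]
      linarith

/-- Dividing by a reduces this to base point 1. The result is a Lipschitz bound whose constant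
degenerates only like a^(s-1) at the boundary. -/
lemma abs_posPow_sub_le_mul {s : ℝ} (hs0 : 0 < s) (hs1 : s < 1) {a : ℝ} (ha : 0 < a) (b : ℝ) :
    |posPow s a - posPow s b| ≤ a ^ (s - 1) * |a - b| := by
  have hb : b = a * (b / a) := by field_simp
  have h1 := abs_one_sub_posPow_le hs0 hs1 (b / a)
  have h2 : posPow s a - posPow s b = a ^ s * (1 - posPow s (b / a)) := by
    rw [hb, posPow_mul ha.le, posPow_of_nonneg ha.le, ← hb]
    ring
  rw [h2, abs_mul, abs_of_nonneg (Real.rpow_nonneg ha.le s)]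
  calc a ^ s * |1 - posPow s (b / a)| ≤ a ^ s * |1 - b / a| := by gcongr
    _ = a ^ (s - 1) * |a - b| := by
      rw [Real.rpow_sub_one ha.ne', show 1 - b / a = (a - b) / a by field_simp, abs_div,
        abs_of_pos ha]
      field_simp

/-- Interpolation: p - 1 of the factors take the s-Hölder bound and the last one the weighted
Lipschitz bound. The gain of 1 - s over the exponent sp makes the Gagliardo density integrable near
the diagonal, and the weights |a|^(s-1) are still locally integrable. -/
lemma abs_posPow_sub_rpow_le {s p : ℝ} (hs0 : 0 < s) (hs1 : s < 1) (hp : 1 < p) (a b : ℝ) :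
    |posPow s a - posPow s b| ^ p ≤
      |a - b| ^ (s * p + (1 - s)) * (|a| ^ (s - 1) + |b| ^ (s - 1)) := by
  have key : ∀ a b : ℝ, 0 < a → |posPow s a - posPow s b| ^ p ≤
      |a - b| ^ (s * p + (1 - s)) * |a| ^ (s - 1) := by
    intro a b ha
    have h1 := abs_posPow_sub_le_mul hs0 hs1 ha b
    have h2 := abs_posPow_sub_le hs0 hs1 a b
    have h3 : |posPow s a - posPow s b| ^ p =
        |posPow s a - posPow s b| ^ (p - 1) * |posPow s a - posPow s b| := by
      rw [← Real.rpow_add_one' (abs_nonneg _) (by linarith)]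
      ring_nf
    rw [h3, abs_of_pos ha]
    calc _ ≤ (|a - b| ^ s) ^ (p - 1) * (a ^ (s - 1) * |a - b|) := by
          gcongr
      _ = (|a - b| ^ (s * (p - 1)) * |a - b|) * a ^ (s - 1) := by
          rw [← Real.rpow_mul (abs_nonneg _)]
          ring
      _ = _ := by
          rw [← Real.rpow_add_one' (abs_nonneg _) (by nlinarith)]
          ring_nf
  have hA := Real.rpow_nonneg (abs_nonneg (a - b)) (s * p + (1 - s))
  have ha := Real.rpow_nonneg (abs_nonneg a) (s - 1)
  have hb := Real.rpow_nonneg (abs_nonneg b) (s - 1)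
  rcases lt_or_ge 0 a with h | h
  · refine (key a b h).trans ?_
    gcongr
    linarith
  rcases lt_or_ge 0 b with h' | h'
  · have := key b a h'
    rw [abs_sub_comm, abs_sub_comm a b]
    rw [abs_sub_comm a b] at hA
    refine this.trans ?_
    gcongr
    linarith
  · rw [posPow_of_nonpos hs0 h, posPow_of_nonpos hs0 h', sub_zero, abs_zero,
      Real.zero_rpow (by linarith)]
    positivity

lemma abs_spow {a q : ℝ} (hq : 0 < q) : |spow a q| = |a| ^ q := by
  unfold spow
  rw [abs_mul, abs_of_nonneg (Real.rpow_nonneg (abs_nonneg a) _)]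
  rw [← Real.rpow_add_one' (abs_nonneg _) (by linarith)]
  ring_nf

lemma spow_of_nonneg {a q : ℝ} (hq : 0 < q) (ha : 0 ≤ a) : spow a q = a ^ q := by
  unfold spow
  rw [abs_of_nonneg ha, ← Real.rpow_add_one' ha (by linarith)]
  ring_nf

lemma spow_neg (a q : ℝ) : spow (-a) q = - spow a q := by
  unfold spow
  rw [abs_neg, mul_neg]

lemma spow_zero (q : ℝ) : spow 0 q = 0 := by simp [spow]

lemma spow_mul {a b q : ℝ} (hq : 0 < q) (ha : 0 ≤ a) : spow (a * b) q = a ^ q * spow b q := by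
  unfold spow
  rw [abs_mul, abs_of_nonneg ha, Real.mul_rpow ha (abs_nonneg _)]
  have : a ^ q = a ^ (q - 1) * a := by
    rw [← Real.rpow_add_one' ha (by linarith)]
    ring_nf
  rw [this]
  ring

@[fun_prop]
lemma measurable_spow (q : ℝ) : Measurable fun a => spow a q := by
  unfold spow
  fun_prop

lemma abs_spow_posPow_sub_le {s p : ℝ} (hs0 : 0 < s) (hs1 : s < 1) (hp : 1 < p) (a b : ℝ) :
    |spow (posPow s a - posPow s b) (p - 1)| ≤ |a - b| ^ (s * (p - 1)) := by
  rw [abs_spow (by linarith), Real.rpow_mul (abs_nonneg _)]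
  exact Real.rpow_le_rpow (abs_nonneg _) (abs_posPow_sub_le hs0 hs1 a b) (by linarith)

/-! ### Integrability of radial powers -/

section Radial

variable {F : Type*} [NormedAddCommGroup F] [NormedSpace ℝ F] [FiniteDimensional ℝ F]
  [MeasurableSpace F] [BorelSpace F] (μ : Measure F) [μ.IsAddHaarMeasure]

/-- With d the dimension, the minimum improves the exponent to -d + 1 - s near the origin, while at
infinity -d - s already suffices. This is the majorant of the residual. -/
lemma integrable_min_norm_mul_rpow [Nontrivial F] {s R : ℝ} (hs0 : 0 < s) (hs1 : s < 1) (hR : 0 < R) :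
    Integrable (fun h : F => min ‖h‖ R * ‖h‖ ^ (-(finrank ℝ F : ℝ) - s)) μ := by
  rw [integrable_fun_norm_addHaar μ (f := fun y => min y R * y ^ (-(finrank ℝ F : ℝ) - s))]
  have hd : 1 ≤ finrank ℝ F := finrank_pos
  have e : ∀ y : ℝ, 0 < y → y ^ (finrank ℝ F - 1) * y ^ (-(finrank ℝ F : ℝ) - s) =
      y ^ (-1 - s) := by
    intro y hy
    rw [← Real.rpow_natCast, ← Real.rpow_add hy]
    push_cast [hd]
    ring_nf
  rw [← Ioc_union_Ioi_eq_Ioi hR.le]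
  refine IntegrableOn.union ?_ ?_
  · have h : IntegrableOn (fun y : ℝ => y ^ (-s)) (Ioc 0 R) := by
      rw [← intervalIntegrable_iff_integrableOn_Ioc_of_le hR.le]
      exact intervalIntegral.intervalIntegrable_rpow' (by linarith)
    refine h.congr_fun (fun y hy => ?_) measurableSet_Ioc
    simp only [smul_eq_mul]
    rw [min_eq_left hy.2, mul_left_comm, e y hy.1, mul_comm, ← Real.rpow_add_one hy.1.ne']
    ring_nf
  · have h : IntegrableOn (fun y : ℝ => R * y ^ (-1 - s)) (Ioi R) :=
      (integrableOn_Ioi_rpow_of_lt (by linarith) hR).const_mul R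
    refine h.congr_fun (fun y hy => ?_) measurableSet_Ioi
    simp only [smul_eq_mul]
    rw [min_eq_right (le_of_lt hy), mul_left_comm, e y (hR.trans hy)]

lemma integrable_indicator_norm_rpow [Nontrivial F] {s R : ℝ} (hs0 : 0 < s) (hR : 0 < R) :
    Integrable ({h : F | R ≤ ‖h‖}.indicator fun h => ‖h‖ ^ (-(finrank ℝ F : ℝ) - s)) μ := by
  have hd : 1 ≤ finrank ℝ F := finrank_pos
  have e : ∀ y : ℝ, 0 < y → y ^ (finrank ℝ F - 1) * y ^ (-(finrank ℝ F : ℝ) - s) =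
      y ^ (-1 - s) := by
    intro y hy
    rw [← Real.rpow_natCast, ← Real.rpow_add hy]
    push_cast [hd]
    ring_nf
  have h0 : ({h : F | R ≤ ‖h‖}.indicator fun h => ‖h‖ ^ (-(finrank ℝ F : ℝ) - s)) =
      fun h => (Ici R).indicator (fun y : ℝ => y ^ (-(finrank ℝ F : ℝ) - s)) ‖h‖ := by
    ext h
    simp [indicator]
  rw [h0, integrable_fun_norm_addHaar μ]
  have h1 : IntegrableOn (fun y : ℝ => y ^ (-1 - s)) (Ici R) := by
    rw [integrableOn_Ici_iff_integrableOn_Ioi]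
    exact integrableOn_Ioi_rpow_of_lt (by linarith) hR
  refine ((integrable_indicator_iff measurableSet_Ici).2 h1).integrableOn.congr_fun
    (fun y hy => ?_) measurableSet_Ioi
  simp only [smul_eq_mul, indicator, mem_Ici]
  split_ifs
  · exact (e y hy).symm
  · simp

/-- Scaling by R. With R proportional to the distance to the boundary, this factor is the
singularity a^(-s) that the Hardy inequality has to absorb. -/
lemma integral_indicator_norm_rpow {s R : ℝ} (hR : 0 < R) :
    ∫ h : F, {h : F | R ≤ ‖h‖}.indicator (fun h => ‖h‖ ^ (-(finrank ℝ F : ℝ) - s)) h ∂μ =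
      R ^ (-s) *
      ∫ h : F, {h : F | 1 ≤ ‖h‖}.indicator (fun h => ‖h‖ ^ (-(finrank ℝ F : ℝ) - s)) h ∂μ := by
  have h := Measure.integral_comp_smul μ
    ({h : F | R ≤ ‖h‖}.indicator fun h => ‖h‖ ^ (-(finrank ℝ F : ℝ) - s)) R
  have h2 : (fun x : F => {h : F | R ≤ ‖h‖}.indicator
      (fun h => ‖h‖ ^ (-(finrank ℝ F : ℝ) - s)) (R • x)) = fun x =>
      R ^ (-(finrank ℝ F : ℝ) - s) * {h : F | 1 ≤ ‖h‖}.indicator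
      (fun h => ‖h‖ ^ (-(finrank ℝ F : ℝ) - s)) x := by
    ext x
    simp only [indicator, mem_ofPred_eq, norm_smul, Real.norm_of_nonneg hR.le, mul_ite, mul_zero]
    rw [Real.mul_rpow hR.le (norm_nonneg _)]
    simp only [le_mul_iff_one_le_right hR]
  rw [h2, integral_const_mul, abs_of_pos (by positivity), smul_eq_mul] at h
  have h3 : R ^ (-s) = R ^ finrank ℝ F * R ^ (-(finrank ℝ F : ℝ) - s) := by
    rw [← Real.rpow_natCast, ← Real.rpow_add hR]
    ring_nf
  rw [h3, mul_assoc, h, ← mul_assoc, mul_inv_cancel₀ (by positivity), one_mul]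

lemma integrableOn_ball_norm_rpow [Nontrivial F] {b R : ℝ} (hb : 0 < b) :
    IntegrableOn (fun h : F => ‖h‖ ^ (-(finrank ℝ F : ℝ) + b)) (Metric.ball 0 R) μ := by
  have hd : 1 ≤ finrank ℝ F := finrank_pos
  rw [integrableOn_fun_norm_addHaar μ (f := fun y => y ^ (-(finrank ℝ F : ℝ) + b))]
  rcases le_or_gt R 0 with hR | hR
  · rw [Ioo_eq_empty (by linarith)]
    exact integrableOn_empty
  have h : IntegrableOn (fun y : ℝ => y ^ (b - 1)) (Ioo 0 R) := by
    refine IntegrableOn.mono_set ?_ Ioo_subset_Ioc_self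
    rw [← intervalIntegrable_iff_integrableOn_Ioc_of_le hR.le]
    exact intervalIntegral.intervalIntegrable_rpow' (by linarith)
  refine h.congr_fun (fun y hy => ?_) measurableSet_Ioo
  simp only [smul_eq_mul]
  rw [← Real.rpow_natCast, ← Real.rpow_add hy.1]
  push_cast [hd]
  ring_nf

end Radial

/-! ### The truncated operator in one dimension -/

lemma measurableSet_offDiag (l a : ℝ) : MeasurableSet {b | offDiag l a b} := by
  unfold offDiag
  exact (measurableSet_le measurable_id measurable_const).union
    (measurableSet_le measurable_const (measurable_const.mul measurable_id))

/-- The pairs that are kept are separated by at least a fixed fraction of the distance a to the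
boundary, so the singularity of the kernel is never reached. -/
lemma offDiag.le_abs_sub {l a b : ℝ} (hl0 : 0 < l) (hl1 : l < 1) (ha : 0 < a)
    (h : offDiag l a b) : (1 - l) * a ≤ |a - b| := by
  rcases h with h | h
  · exact le_trans (by linarith) (le_abs_self _)
  · have hb : 0 < b := by
      by_contra hb
      have := mul_nonpos_of_nonneg_of_nonpos hl0.le (not_lt.1 hb)
      linarith
    rw [abs_sub_comm]
    refine le_trans ?_ (le_abs_self _)
    have h1 : a ≤ b := h.trans (mul_le_of_le_one_left hb.le hl1.le)
    have h2 : l * (b - a) ≤ b - a := mul_le_of_le_one_left (sub_nonneg.2 h1) hl1.le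
    linarith

lemma offDiag_mul {l a b c : ℝ} (hc : 0 < c) : offDiag l (c * a) (c * b) ↔ offDiag l a b := by
  unfold offDiag
  rw [mul_left_comm, mul_le_mul_iff_right₀ hc, mul_left_comm l c b, mul_le_mul_iff_right₀ hc]

/-- The truncated integrand of the one-dimensional operator applied to `b ↦ b_+^s`. -/
noncomputable def truncInt (s p l a b : ℝ) : ℝ :=
  {b | offDiag l a b}.indicator (fun b => spow (posPow s a - posPow s b) (p - 1)) b

lemma measurable_truncInt {s : ℝ} (hs : 0 < s) (p l a : ℝ) : Measurable (truncInt s p l a) := by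
  refine Measurable.indicator ?_ (measurableSet_offDiag l a)
  exact (measurable_spow _).comp (measurable_const.sub (continuous_posPow hs.le).measurable)

lemma truncInt_mul {s p l a b c : ℝ} (hp : 1 < p) (hc : 0 < c) :
    truncInt s p l (c * a) (c * b) = c ^ (s * (p - 1)) * truncInt s p l a b := by
  unfold truncInt
  by_cases h : offDiag l a b
  · rw [indicator_of_mem (by exact (offDiag_mul hc).2 h), indicator_of_mem (by exact h),
      posPow_mul hc.le, posPow_mul hc.le, ← mul_sub, spow_mul (by linarith)
      (Real.rpow_nonneg hc.le _), ← Real.rpow_mul hc.le]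
  · rw [indicator_of_notMem (by exact fun h' => h ((offDiag_mul hc).1 h')),
      indicator_of_notMem (by exact h), mul_zero]

lemma abs_truncInt_le {s p : ℝ} (hs0 : 0 < s) (hs1 : s < 1) (hp : 1 < p) (l a b : ℝ) :
    |truncInt s p l a b| ≤ |a - b| ^ (s * (p - 1)) := by
  unfold truncInt indicator
  split_ifs
  · exact abs_spow_posPow_sub_le hs0 hs1 hp a b
  · rw [abs_zero]
    exact Real.rpow_nonneg (abs_nonneg _) _

lemma integrable_truncInt_mul {s p l : ℝ} (hs0 : 0 < s) (hs1 : s < 1) (hp : 1 < p)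
    (hl0 : 0 < l) (hl1 : l < 1) :
    Integrable fun t => truncInt s p l 1 t * |1 - t| ^ (-1 - p * s) := by
  have h := (integrable_indicator_norm_rpow (F := ℝ) volume hs0 (sub_pos.2 hl1)).comp_sub_left 1
  refine h.mono ?_ (Eventually.of_forall fun t => ?_)
  · exact ((measurable_truncInt hs0 p l 1).mul (by fun_prop)).aestronglyMeasurable
  · simp only [Module.finrank_self, Nat.cast_one]
    by_cases ht : offDiag l 1 t
    · have h1 := ht.le_abs_sub hl0 hl1 one_pos
      rw [mul_one] at h1
      have hpos : 0 < |1 - t| := lt_of_lt_of_le (by linarith) h1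
      rw [indicator_of_mem (by simpa using h1), norm_mul]
      simp only [Real.norm_eq_abs]
      rw [abs_of_nonneg (Real.rpow_nonneg (abs_nonneg (1 - t)) _),
        abs_of_nonneg (Real.rpow_nonneg (abs_nonneg (1 - t)) _)]
      calc _ ≤ |1 - t| ^ (s * (p - 1)) * |1 - t| ^ (-1 - p * s) := by
            gcongr
            exact abs_truncInt_le hs0 hs1 hp l 1 t
        _ = _ := by
            rw [← Real.rpow_add hpos]
            ring_nf
    · rw [truncInt, indicator_of_notMem (by simpa using ht), zero_mul, norm_zero]
      exact norm_nonneg _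

lemma integral_Iic_one_sub_rpow {q : ℝ} (hq : 0 < q) :
    ∫ t in Iic (0 : ℝ), (1 - t) ^ (-1 - q) = 1 / q := by
  have h1 := integral_sub_left_eq_self (fun t : ℝ => (Ici 1).indicator (fun t => t ^ (-1 - q)) t)
    volume 1
  have h2 := integral_Ioi_rpow_of_lt (a := -1 - q) (by linarith) one_pos
  rw [integral_indicator measurableSet_Ici, integral_Ici_eq_integral_Ioi, h2] at h1
  rw [← integral_indicator measurableSet_Iic]
  convert h1 using 1
  · congr 1
    ext t
    simp [indicator]
  · rw [Real.one_rpow]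
    field_simp
    ring_nf
    field_simp

/-- An antiderivative of the symmetrized one-dimensional integrand. -/
lemma hasDerivAt_symmetrized {s p x : ℝ} (hs0 : 0 < s) (hp : 1 < p) (hx0 : 0 < x) (hx1 : x < 1) :
    HasDerivAt (fun x : ℝ => (1 - x ^ s) ^ p * (1 - x) ^ (-(p * s)) / (p * s))
      ((1 - x ^ s) ^ (p - 1) * (1 - x) ^ (-1 - p * s) * (1 - x ^ (s - 1))) x := by
  have hxs : x ^ s < 1 := Real.rpow_lt_one hx0.le hx1 hs0
  have h1 : HasDerivAt (fun x : ℝ => 1 - x ^ s) (-(s * x ^ (s - 1))) x :=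
    (Real.hasDerivAt_rpow_const (Or.inl hx0.ne')).const_sub 1
  have h2 : HasDerivAt (fun x : ℝ => 1 - x) (-1) x := (hasDerivAt_id x).const_sub 1
  have h3 := h1.rpow_const (p := p) (Or.inl (by linarith))
  have h4 := h2.rpow_const (p := -(p * s)) (Or.inl (by linarith))
  refine ((h3.mul h4).div_const (p * s)).congr_deriv ?_
  have e1 : (1 - x ^ s) ^ p = (1 - x ^ s) ^ (p - 1) * (1 - x ^ s) := by
    rw [← Real.rpow_add_one (by linarith)]
    ring_nf
  have e2 : (1 - x) ^ (-(p * s)) = (1 - x) ^ (-1 - p * s) * (1 - x) := by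
    rw [← Real.rpow_add_one (by linarith)]
    ring_nf
  have e3 : (1 - x) ^ (-(p * s) - 1) = (1 - x) ^ (-1 - p * s) := by ring_nf
  have e4 : x ^ s = x ^ (s - 1) * x := by
    rw [← Real.rpow_add_one hx0.ne']
    ring_nf
  -- Once the common powers are factored out, the claim is the identity (1 - x^s) - x^(s-1) (1 - x)
  -- = 1 - x^(s-1).
  rw [e1, e2, e3]
  have : p * s ≠ 0 := by positivity
  field_simp
  rw [e4]
  ring

/-- The integrand is an exact derivative. The boundary value 1/(ps) at 0 is what the negative
half-line contributes with the opposite sign, and this cancellation is why b_+^s is a solution. -/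
lemma integral_symmetrized {s p l : ℝ} (hs0 : 0 < s) (hs1 : s < 1) (hp : 1 < p) (hl0 : 0 < l)
    (hl1 : l < 1)
    (hint : IntegrableOn (fun x : ℝ => (1 - x ^ s) ^ (p - 1) * (1 - x) ^ (-1 - p * s) *
      (1 - x ^ (s - 1))) (Ioc 0 l)) :
    ∫ x in Ioc 0 l, (1 - x ^ s) ^ (p - 1) * (1 - x) ^ (-1 - p * s) * (1 - x ^ (s - 1)) =
      (1 - l ^ s) ^ p * (1 - l) ^ (-(p * s)) / (p * s) - 1 / (p * s) := by
  rw [← intervalIntegral.integral_of_le hl0.le,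
    intervalIntegral.integral_eq_sub_of_hasDerivAt_of_le hl0.le
      (f := fun x : ℝ => (1 - x ^ s) ^ p * (1 - x) ^ (-(p * s)) / (p * s))]
  · simp [hs0.ne']
  · refine ContinuousOn.div_const (ContinuousOn.mul ?_ ?_) _
    · refine ContinuousOn.rpow_const (continuousOn_const.sub
        (continuousOn_id.rpow_const fun x _ => Or.inr hs0.le)) fun x _ => Or.inr (by linarith)
    · exact ContinuousOn.rpow_const (continuousOn_const.sub continuousOn_id)
        fun x hx => Or.inl (by linarith [hx.2])
  · exact fun x hx => hasDerivAt_symmetrized hs0 hp hx.1 (hx.2.trans hl1)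
  · rwa [intervalIntegrable_iff_integrableOn_Ioc_of_le hl0.le]

/-- The truncated one-dimensional operator applied to `b ↦ b_+^s`, evaluated at `1`. -/
lemma integral_truncInt_one {s p l : ℝ} (hs0 : 0 < s) (hs1 : s < 1) (hp : 1 < p) (hl0 : 0 < l)
    (hl1 : l < 1) :
    ∫ t, truncInt s p l 1 t * |1 - t| ^ (-1 - p * s) =
      (1 - l ^ s) ^ p * (1 - l) ^ (-(p * s)) / (p * s) := by
  have hps : 0 < p * s := by positivity
  have hint := integrable_truncInt_mul hs0 hs1 hp hl0 hl1
  set g : ℝ → ℝ := fun t => truncInt s p l 1 t * |1 - t| ^ (-1 - p * s) with hg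
  have hneg : ∫ t in Iic 0, g t = 1 / (p * s) := by
    rw [← integral_Iic_one_sub_rpow hps]
    refine setIntegral_congr_fun measurableSet_Iic fun t ht => ?_
    have ht : t ≤ 0 := ht
    have hm : offDiag l 1 t := Or.inl (by linarith)
    simp only [hg]
    rw [truncInt, indicator_of_mem (by exact hm), posPow_of_nonpos hs0 ht,
      posPow_of_nonneg zero_le_one, Real.one_rpow, sub_zero, spow_of_nonneg (by linarith)
      zero_le_one, Real.one_rpow, one_mul, abs_of_nonneg (by linarith)]
  -- split the positive half line according to the two branches of the truncation
  set g1 : ℝ → ℝ := (Iic l).indicator g with hg1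
  set g2 : ℝ → ℝ := (Ioi l).indicator g with hg2
  have hsum : g = g1 + g2 := by
    rw [hg1, hg2, ← compl_Iic, indicator_self_add_compl]
  have hi1 : IntegrableOn g1 (Ioi 0) := (hint.indicator measurableSet_Iic).integrableOn
  have hi2 : IntegrableOn g2 (Ioi 0) := (hint.indicator measurableSet_Ioi).integrableOn
  -- The inversion t = 1/x folds the outer branch t ≥ 1/l onto (0, l], where it is added to the
  -- inner branch.
  have hsub := integral_comp_rpow_Ioi g2 (p := -1) (by norm_num)
  have hi2' := (integrableOn_Ioi_comp_rpow_iff g2 (p := -1) (by norm_num)).2 hi2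
  have hpt : ∀ x ∈ Ioi (0 : ℝ), g1 x + (|(-1 : ℝ)| * x ^ ((-1 : ℝ) - 1)) • g2 (x ^ (-1 : ℝ)) =
      (Ioc 0 l).indicator (fun x => (1 - x ^ s) ^ (p - 1) * (1 - x) ^ (-1 - p * s) *
        (1 - x ^ (s - 1))) x := by
    intro x hx
    have hx : 0 < x := hx
    rw [Real.rpow_neg_one]
    by_cases hxl : x ≤ l
    · have hx1 : x < 1 := hxl.trans_lt hl1
      have hxs : x ^ s < 1 := Real.rpow_lt_one hx.le hx1 hs0
      have hm : offDiag l 1 x := Or.inl (by linarith)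
      have hinv : 1 < x⁻¹ := (one_lt_inv₀ hx).2 hx1
      have hm' : offDiag l 1 x⁻¹ := Or.inr (by
        rw [← div_eq_mul_inv, le_div_iff₀ hx]
        linarith)
      rw [hg1, hg2, indicator_of_mem (by exact hxl), indicator_of_mem (show x⁻¹ ∈ Ioi l by
        exact hl1.trans hinv), indicator_of_mem (by exact ⟨hx, hxl⟩)]
      simp only [hg]
      rw [truncInt, indicator_of_mem (by exact hm), truncInt, indicator_of_mem (by exact hm'),
        posPow_of_nonneg hx.le, posPow_of_nonneg zero_le_one, Real.one_rpow,
        posPow_of_nonneg (inv_pos.2 hx).le, spow_of_nonneg (by linarith) (by linarith),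
        abs_of_nonneg (show 0 ≤ 1 - x by linarith), Real.inv_rpow hx.le]
      have e1 : 1 - (x ^ s)⁻¹ = -((x ^ s)⁻¹ * (1 - x ^ s)) := by
        have := (Real.rpow_pos_of_pos hx s).ne'
        field_simp
        ring
      have e2 : |1 - x⁻¹| = x⁻¹ * (1 - x) := by
        rw [abs_of_nonpos (by linarith)]
        field_simp
        ring
      rw [e1, e2, spow_neg, spow_mul (by linarith) (by positivity),
        spow_of_nonneg (by linarith) (by linarith), Real.mul_rpow (by positivity) (by linarith),
        Real.inv_rpow hx.le, ← Real.rpow_neg hx.le,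
        ← Real.rpow_mul hx.le, ← Real.rpow_neg hx.le]
      -- The Jacobian x^(-2), the signed power x^(-s(p-1)) and the kernel x^(1+ps) combine to
      -- x^(s-1).
      have e3 : x ^ (s - 1) = x ^ ((-1 : ℝ) - 1) * x ^ (-s * (p - 1)) * x ^ (-(-1 - p * s)) := by
        rw [← Real.rpow_add hx, ← Real.rpow_add hx]
        ring_nf
      rw [e3]
      simp only [abs_neg, abs_one, one_mul, smul_eq_mul]
      ring
    -- For x > l both terms vanish: x lies outside the inner branch, and 1/x is below 1/l, hence in
    -- the removed gap (l, 1/l) or outside the support of `g2`.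
    · rw [hg1, indicator_of_notMem (by exact hxl), indicator_of_notMem (by
        intro h; exact hxl h.2), zero_add]
      have : g2 x⁻¹ = 0 := by
        rw [hg2]
        by_cases h : x⁻¹ ∈ Ioi l
        · rw [indicator_of_mem h]
          simp only [hg]
          rw [truncInt, indicator_of_notMem, zero_mul]
          rintro (h1 | h1)
          · have h : l < x⁻¹ := h
            linarith
          · rw [← div_eq_mul_inv, le_div_iff₀ hx, one_mul] at h1
            exact hxl h1
        · rw [indicator_of_notMem h]
      rw [this, smul_zero]
  have hpos : ∫ t in Ioi 0, g t = (1 - l ^ s) ^ p * (1 - l) ^ (-(p * s)) / (p * s) -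
      1 / (p * s) := by
    have hadd := integral_add hi1 hi2'
    rw [hsum]
    simp only [Pi.add_apply]
    rw [integral_add hi1 hi2, ← hsub, ← hadd, setIntegral_congr_fun measurableSet_Ioi hpt,
      setIntegral_indicator measurableSet_Ioc, inter_eq_self_of_subset_right
      (fun x hx => hx.1), integral_symmetrized hs0 hs1 hp hl0 hl1]
    have h3 := (hi1.add hi2').congr_fun hpt measurableSet_Ioi
    have h4 := h3.mono_set (show Ioc 0 l ⊆ Ioi 0 from fun x hx => hx.1)
    exact h4.congr_fun (fun x hx => indicator_of_mem hx _) measurableSet_Ioc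
  rw [← intervalIntegral.integral_Iic_add_Ioi hint.integrableOn hint.integrableOn (b := 0), hneg,
    hpos]
  ring

lemma integral_truncInt_one_nonneg {s p l : ℝ} (hs0 : 0 < s) (hp : 1 < p) (hl0 : 0 < l)
    (hl1 : l < 1) : 0 ≤ (1 - l ^ s) ^ p * (1 - l) ^ (-(p * s)) / (p * s) := by
  have h1 : l ^ s < 1 := Real.rpow_lt_one hl0.le hl1 hs0
  have h2 : 0 ≤ 1 - l ^ s := by linarith
  have h3 : 0 ≤ 1 - l := by linarith
  positivity

/-- Since l ≤ l^s, the factor 1 - l^s is at most 1 - l. The positive exponent p(1 - s) left over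
gives both the uniform bound and the limit 0. -/
lemma integral_truncInt_one_le {s p l : ℝ} (hs0 : 0 < s) (hs1 : s < 1) (hp : 1 < p) (hl0 : 0 < l)
    (hl1 : l < 1) :
    (1 - l ^ s) ^ p * (1 - l) ^ (-(p * s)) / (p * s) ≤ (1 - l) ^ (p * (1 - s)) / (p * s) := by
  have h1 : l ^ s < 1 := Real.rpow_lt_one hl0.le hl1 hs0
  have h2 : l ≤ l ^ s := by simpa using Real.rpow_le_rpow_of_exponent_ge hl0 hl1.le hs1.le
  have h3 : 0 < 1 - l := by linarith
  gcongr
  calc _ ≤ (1 - l) ^ p * (1 - l) ^ (-(p * s)) := by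
        gcongr
    _ = _ := by
        rw [← Real.rpow_add h3]
        ring_nf

lemma integral_truncInt_one_le_inv {s p l : ℝ} (hs0 : 0 < s) (hs1 : s < 1) (hp : 1 < p)
    (hl0 : 0 < l) (hl1 : l < 1) :
    (1 - l ^ s) ^ p * (1 - l) ^ (-(p * s)) / (p * s) ≤ 1 / (p * s) := by
  refine (integral_truncInt_one_le hs0 hs1 hp hl0 hl1).trans ?_
  gcongr
  exact Real.rpow_le_one (by linarith) (by linarith) (by nlinarith)

lemma tendsto_integral_truncInt_one {s p : ℝ} (hs0 : 0 < s) (hs1 : s < 1) (hp : 1 < p) :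
    Tendsto (fun l : ℝ => (1 - l ^ s) ^ p * (1 - l) ^ (-(p * s)) / (p * s)) (𝓝[<] 1) (𝓝 0) := by
  have hmem : ∀ᶠ l : ℝ in 𝓝[<] 1, l ∈ Ioo (0 : ℝ) 1 := Ioo_mem_nhdsLT one_pos
  have h : Tendsto (fun l : ℝ => (1 - l) ^ (p * (1 - s)) / (p * s)) (𝓝[<] 1) (𝓝 0) := by
    have hc : Continuous (fun l : ℝ => (1 - l) ^ (p * (1 - s)) / (p * s)) :=
      ((continuous_const.sub continuous_id).rpow_const fun _ => Or.inr (by nlinarith)).div_const _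
    have := (hc.tendsto 1).mono_left (nhdsWithin_le_nhds (s := Iio 1))
    simpa [Real.zero_rpow (show p * (1 - s) ≠ 0 by
      have : 0 < p * (1 - s) := mul_pos (by linarith) (by linarith)
      exact this.ne')] using this
  refine tendsto_of_tendsto_of_tendsto_of_le_of_le' tendsto_const_nhds h ?_ ?_
  · filter_upwards [hmem] with l hl
    exact integral_truncInt_one_nonneg hs0 hp hl.1 hl.2
  · filter_upwards [hmem] with l hl
    exact integral_truncInt_one_le hs0 hs1 hp hl.1 hl.2

/-- The truncated one-dimensional operator applied to `b ↦ b_+^s`, in increments. -/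
lemma integral_truncInt_sub {s p l a : ℝ} (hs0 : 0 < s) (hs1 : s < 1) (hp : 1 < p) (hl0 : 0 < l)
    (hl1 : l < 1) (ha : 0 < a) :
    ∫ t, truncInt s p l a (a - t) * |t| ^ (-1 - p * s) =
      a ^ (-s) * ((1 - l ^ s) ^ p * (1 - l) ^ (-(p * s)) / (p * s)) := by
  rw [← integral_truncInt_one hs0 hs1 hp hl0 hl1,
    ← integral_sub_left_eq_self (fun t => truncInt s p l 1 t * |1 - t| ^ (-1 - p * s)) volume 1]
  simp only [sub_sub_cancel]
  have h := Measure.integral_comp_mul_left (fun t => truncInt s p l a (a - t) *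
    |t| ^ (-1 - p * s)) a
  have e : ∀ x, truncInt s p l a (a - a * x) * |a * x| ^ (-1 - p * s) =
      (a ^ (s * (p - 1)) * a ^ (-1 - p * s)) *
        (truncInt s p l 1 (1 - x) * |x| ^ (-1 - p * s)) := by
    intro x
    have := truncInt_mul (s := s) (l := l) (a := 1) (b := 1 - x) hp ha
    rw [mul_one, mul_sub, mul_one] at this
    rw [this, abs_mul, abs_of_pos ha, Real.mul_rpow ha.le (abs_nonneg _)]
    ring
  simp_rw [e] at h
  rw [integral_const_mul, ← Real.rpow_add ha, abs_of_pos (by positivity), smul_eq_mul] at h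
  have e2 : a ^ (-s) = a * a ^ (s * (p - 1) + (-1 - p * s)) := by
    rw [mul_comm, ← Real.rpow_add_one ha.ne']
    ring_nf
  rw [e2, mul_assoc, h, ← mul_assoc, mul_inv_cancel₀ ha.ne', one_mul]

/-! ### Integrating out the tangential coordinates -/

/-- The vector with last coordinate `t` and remaining coordinates `k`. -/
noncomputable def appendCoord {n : ℕ} (z : ℝ × (Fin n → ℝ)) : E (n + 1) :=
  WithLp.toLp 2 ((Fin.last n).insertNth z.1 z.2 : Fin (n + 1) → ℝ)

lemma appendCoord_last {n : ℕ} (z : ℝ × (Fin n → ℝ)) : appendCoord z (Fin.last n) = z.1 := by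
  simp [appendCoord]

lemma appendCoord_succAbove {n : ℕ} (z : ℝ × (Fin n → ℝ)) (j : Fin n) :
    appendCoord z ((Fin.last n).succAbove j) = z.2 j := by
  simp only [appendCoord, Fin.insertNth_apply_succAbove]

lemma appendCoord_smul {n : ℕ} (t : ℝ) (z : ℝ × (Fin n → ℝ)) :
    appendCoord (t • z) = t • appendCoord z := by
  ext i
  rcases Fin.eq_self_or_eq_succAbove (Fin.last n) i with h | ⟨j, h⟩
  · rw [h, PiLp.smul_apply, appendCoord_last, appendCoord_last]
    rfl
  · rw [h, PiLp.smul_apply, appendCoord_succAbove, appendCoord_succAbove]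
    rfl

lemma measurePreserving_appendCoord (n : ℕ) :
    MeasurePreserving (appendCoord (n := n)) := by
  exact (PiLp.volume_preserving_toLp (Fin (n + 1))).comp
    ((volume_preserving_piFinSuccAbove (fun _ : Fin (n + 1) => ℝ) (Fin.last n)).symm _)

lemma measurableEmbedding_appendCoord (n : ℕ) : MeasurableEmbedding (appendCoord (n := n)) := by
  exact (MeasurableEquiv.toLp 2 (Fin (n + 1) → ℝ)).measurableEmbedding.comp
    (MeasurableEquiv.piFinSuccAbove (fun _ : Fin (n + 1) => ℝ) (Fin.last n)).symm.measurableEmbedding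

lemma one_add_norm_le_two_mul_norm_appendCoord {n : ℕ} (k : Fin n → ℝ) :
    1 + ‖k‖ ≤ 2 * ‖appendCoord (1, k)‖ := by
  have h1 : 1 ≤ ‖appendCoord (1, k)‖ := by
    have := PiLp.norm_apply_le (appendCoord (1, k)) (Fin.last n)
    rwa [appendCoord_last, norm_one] at this
  have h2 : ‖k‖ ≤ ‖appendCoord (1, k)‖ := by
    refine (pi_norm_le_iff_of_nonneg (norm_nonneg _)).2 fun j => ?_
    have := PiLp.norm_apply_le (appendCoord (1, k)) ((Fin.last n).succAbove j)
    rwa [appendCoord_succAbove] at this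
  linarith

/-- Integrating a function of the last coordinate against an even homogeneous kernel reduces to
the one-dimensional kernel of the same order. -/
lemma exists_integral_lastCoord_mul_kernel {N : ℕ} (hN : 1 ≤ N) {a c : ℝ} (ha : 0 < a)
    (hc : 0 < c) :
    ∃ B : ℝ, 0 ≤ B ∧ ∀ A : E N →L[ℝ] E N, (∀ h, c * ‖h‖ ≤ ‖A h‖) → ∃ cA : ℝ, |cA| ≤ B ∧
      ∀ g : ℝ → ℝ, Integrable (fun h => g (lastCoord hN h) * ‖A h‖ ^ (-(N : ℝ) - a)) →
        ∫ h, g (lastCoord hN h) * ‖A h‖ ^ (-(N : ℝ) - a) = cA * ∫ t, g t * |t| ^ (-1 - a) := by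
  obtain ⟨n, rfl⟩ : ∃ n, N = n + 1 := ⟨N - 1, by omega⟩
  have hlast : ∀ x : E (n + 1), lastCoord hN x = x (Fin.last n) := fun x => rfl
  have hint : Integrable fun k : Fin n → ℝ =>
      (c / 2) ^ (-((n + 1 : ℕ) : ℝ) - a) * (1 + ‖k‖) ^ (-((n + 1 : ℕ) : ℝ) - a) := by
    have := integrable_one_add_norm (E := Fin n → ℝ) (μ := volume) (r := ((n + 1 : ℕ) : ℝ) + a)
      (by simp; linarith)
    rw [neg_add'] at this
    exact this.const_mul _
  -- The constant of A is its kernel integrated over the hyperplane of last coordinate 1. The bound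
  -- ‖A(1, k)‖ ≥ c (1 + ‖k‖) / 2 dominates it uniformly in A.
  refine ⟨∫ k : Fin n → ℝ, (c / 2) ^ (-((n + 1 : ℕ) : ℝ) - a) * (1 + ‖k‖) ^
    (-((n + 1 : ℕ) : ℝ) - a), integral_nonneg fun k => by positivity, fun A hA => ?_⟩
  refine ⟨∫ k : Fin n → ℝ, ‖A (appendCoord (1, k))‖ ^ (-((n + 1 : ℕ) : ℝ) - a), ?_, ?_⟩
  · rw [abs_of_nonneg (integral_nonneg fun k => by positivity)]
    refine integral_mono_of_nonneg (Eventually.of_forall fun k => by positivity) hint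
      (Eventually.of_forall fun k => ?_)
    have h1 := one_add_norm_le_two_mul_norm_appendCoord k
    have h2 := hA (appendCoord (1, k))
    simp only
    rw [← Real.mul_rpow (by positivity) (by positivity)]
    have h3 : 0 < 1 + ‖k‖ := by positivity
    refine Real.rpow_le_rpow_of_nonpos (by positivity) (by nlinarith) ?_
    have : (0 : ℝ) ≤ ((n + 1 : ℕ) : ℝ) := Nat.cast_nonneg _
    linarith
  · intro g hg
    have hmp := measurePreserving_appendCoord n
    have hme := measurableEmbedding_appendCoord n
    rw [← hmp.integral_comp hme]
    rw [← hmp.integrable_comp_emb hme] at hg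
    rw [Measure.volume_eq_prod] at hg ⊢
    have hF := integral_prod _ hg
    simp only [Function.comp_def] at hF
    rw [hF, ← integral_const_mul]
    refine integral_congr_ae ?_
    filter_upwards [compl_mem_ae_iff.2 (measure_singleton (0 : ℝ))] with t ht
    have ht : t ≠ 0 := ht
    simp only [hlast, appendCoord_last]
    rw [integral_const_mul]
    -- Replacing k by t k on the slice of height t ≠ 0 gives |t|^n |t|^(-(n+1)-a) = |t|^(-1-a) by
    -- homogeneity; evenness accounts for negative t.
    have h1 := Measure.integral_comp_smul volume (fun k : Fin n → ℝ =>
      ‖A (appendCoord (t, k))‖ ^ (-((n + 1 : ℕ) : ℝ) - a)) t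
    have h2 : ∀ k : Fin n → ℝ, ‖A (appendCoord (t, t • k))‖ ^ (-((n + 1 : ℕ) : ℝ) - a) =
        |t| ^ (-((n + 1 : ℕ) : ℝ) - a) *
          ‖A (appendCoord (1, k))‖ ^ (-((n + 1 : ℕ) : ℝ) - a) := by
      intro k
      have : (t, t • k) = t • ((1 : ℝ), k) := by simp
      rw [this, appendCoord_smul, map_smul, norm_smul, Real.norm_eq_abs,
        Real.mul_rpow (abs_nonneg _) (norm_nonneg _)]
    simp_rw [h2] at h1
    rw [integral_const_mul, finrank_fin_fun, abs_inv, abs_pow, smul_eq_mul] at h1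
    have ht' : 0 < |t| := abs_pos.2 ht
    have h3 : |t| ^ (-1 - a) = |t| ^ n * |t| ^ (-((n + 1 : ℕ) : ℝ) - a) := by
      rw [← Real.rpow_natCast, ← Real.rpow_add ht']
      push_cast
      ring_nf
    rw [h3]
    have h4 : ∫ k : Fin n → ℝ, ‖A (appendCoord (t, k))‖ ^ (-((n + 1 : ℕ) : ℝ) - a) =
        |t| ^ n * (|t| ^ (-((n + 1 : ℕ) : ℝ) - a) *
          ∫ k : Fin n → ℝ, ‖A (appendCoord (1, k))‖ ^ (-((n + 1 : ℕ) : ℝ) - a)) := by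
      rw [h1, ← mul_assoc, mul_inv_cancel₀ (by positivity), one_mul]
    rw [h4]
    ring

/-- The ball lies in a cube, where the integral factors and only a one-dimensional power b > -1
remains. -/
lemma lintegral_ball_abs_lastCoord_rpow_lt_top {N : ℕ} (hN : 1 ≤ N) {b : ℝ} (hb : -1 < b)
    (R : ℝ) :
    ∫⁻ x in Metric.ball (0 : E N) R, ENNReal.ofReal (|lastCoord hN x| ^ b) < ∞ := by
  obtain ⟨n, rfl⟩ : ∃ n, N = n + 1 := ⟨N - 1, by omega⟩
  have hlast : ∀ x : E (n + 1), lastCoord hN x = x (Fin.last n) := fun x => rfl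
  set S : Set (E (n + 1)) := {x | |x (Fin.last n)| ≤ R ∧ ∀ j : Fin n,
    |x ((Fin.last n).succAbove j)| ≤ R} with hS
  have hsub : Metric.ball (0 : E (n + 1)) R ⊆ S := fun x hx => by
    have hx : ‖x‖ < R := by simpa using hx
    exact ⟨(PiLp.norm_apply_le x _).trans hx.le, fun j => (PiLp.norm_apply_le x _).trans hx.le⟩
  have hmp := measurePreserving_appendCoord n
  have hme := measurableEmbedding_appendCoord n
  refine (lintegral_mono_set hsub).trans_lt ?_
  rw [← hmp.setLIntegral_comp_preimage_emb hme]
  have hpre : appendCoord ⁻¹' S = Icc (-R) R ×ˢ (Set.univ.pi fun _ : Fin n => Icc (-R) R) := by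
    ext z
    rw [mem_prod, Set.mem_pi, mem_preimage, hS, mem_ofPred_eq, appendCoord_last]
    simp only [appendCoord_succAbove, mem_Icc, abs_le, mem_univ, true_implies]
  rw [hpre, Measure.volume_eq_prod, ← Measure.prod_restrict]
  simp only [hlast, appendCoord_last]
  rw [lintegral_prod _ (by fun_prop)]
  simp only [lintegral_const]
  rw [lintegral_mul_const _ (by fun_prop)]
  refine ENNReal.mul_lt_top ?_ ?_
  · have h := integrableOn_ball_norm_rpow (F := ℝ) volume (b := b + 1) (R := R + 1) (by linarith)
    rw [finrank_self, Nat.cast_one, neg_add_cancel_comm_assoc] at h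
    have h1 := h.mono_set (show Icc (-R) R ⊆ Metric.ball 0 (R + 1) from fun t ht => by
      rw [mem_ball_zero_iff, Real.norm_eq_abs]
      linarith [abs_le.2 ht])
    exact h1.lintegral_lt_top
  · rw [Measure.restrict_apply_univ, volume_pi_pi]
    exact ENNReal.prod_lt_top fun _ _ => by
      rw [Real.volume_Icc]
      exact ENNReal.ofReal_lt_top

/-! ### Quantitative control of the diffeomorphism -/

/-- A Lipschitz function whose derivative is almost everywhere bounded by `K` is `K`-Lipschitz. -/
lemma norm_sub_le_of_ae_norm_fderiv_le {F G : Type*} [NormedAddCommGroup F] [NormedSpace ℝ F]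
    [FiniteDimensional ℝ F] [MeasurableSpace F] [BorelSpace F] (μ : Measure F)
    [μ.IsAddHaarMeasure] [NormedAddCommGroup G] [NormedSpace ℝ G] [FiniteDimensional ℝ G]
    {g : F → G} {L : ℝ≥0} (hg : LipschitzWith L g) {K : ℝ}
    (hK : ∀ᵐ x ∂μ, ‖fderiv ℝ g x‖ ≤ K) (x y : F) : ‖g x - g y‖ ≤ K * ‖x - y‖ := by
  obtain ⟨S, hSsub, hSm, hS⟩ : ∃ S ⊆ {z | DifferentiableAt ℝ g z ∧ ‖fderiv ℝ g z‖ ≤ K},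
      MeasurableSet S ∧ ∀ᵐ z ∂μ, z ∈ S := by
    have h := hg.ae_differentiableAt.and hK
    obtain ⟨T, hT1, hT2, hT3⟩ := exists_measurable_superset_of_null (ae_iff.1 h)
    refine ⟨Tᶜ, fun z hz => ?_, hT2.compl, compl_mem_ae_iff.2 hT3⟩
    by_contra h'
    exact hz (hT1 h')
  set v := x - y with hv
  -- The derivative bound is known only off a null set, which may contain a given segment. By Fubini
  -- and translation invariance, almost every parallel line meets that set in a null set.
  have hae : ∀ᵐ z ∂μ, ∀ᵐ t : ℝ, z + t • v ∈ S := by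
    rw [Measure.ae_ae_comm (μ := μ) (ν := volume)]
    · refine Eventually.of_forall fun t => ?_
      exact (measurePreserving_add_right μ (t • v)).quasiMeasurePreserving.ae hS
    · have hm : Measurable fun q : F × ℝ => q.1 + q.2 • v := by fun_prop
      exact hm hSm
  have key : ∀ᵐ z ∂μ, ‖g (z + v) - g z‖ ≤ K * ‖v‖ := by
    filter_upwards [hae] with z hz
    -- A norming functional reduces to a scalar Lipschitz function on the line, for which the
    -- fundamental theorem of calculus holds.
    obtain ⟨l, hl1, hl2⟩ := exists_dual_vector'' ℝ (g (z + v) - g z)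
    set φ : ℝ → ℝ := fun t => l (g (z + t • v)) with hφ
    have hφL : LipschitzWith (‖l‖₊ * (L * ‖v‖₊)) φ := by
      refine l.lipschitz.comp (hg.comp ?_)
      refine LipschitzWith.of_dist_le_mul fun a b => ?_
      rw [dist_add_left, dist_eq_norm, ← sub_smul, norm_smul, coe_nnnorm, mul_comm, dist_eq_norm]
    have hFTC := (hφL.lipschitzOnWith (s := uIcc 0 1)).absolutelyContinuousOnInterval
      |>.integral_deriv_eq_sub
    have hder : ∀ᵐ t : ℝ, ‖deriv φ t‖ ≤ K * ‖v‖ := by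
      filter_upwards [hz] with t ht
      obtain ⟨hd, hn⟩ := hSsub ht
      have hline : HasDerivAt (fun t : ℝ => z + t • v) v t := by
        simpa using ((hasDerivAt_id t).smul_const v).const_add z
      have h1 := l.hasFDerivAt.comp_hasDerivAt t (hd.hasFDerivAt.comp_hasDerivAt t hline)
      have h2 : deriv φ t = l (fderiv ℝ g (z + t • v) v) := h1.deriv
      rw [h2]
      calc _ ≤ ‖l‖ * ‖fderiv ℝ g (z + t • v) v‖ := l.le_opNorm _
        _ ≤ 1 * (‖fderiv ℝ g (z + t • v)‖ * ‖v‖) := by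
          gcongr
          exact ContinuousLinearMap.le_opNorm _ _
        _ ≤ K * ‖v‖ := by
          rw [one_mul]
          gcongr
    have h3 := intervalIntegral.norm_integral_le_of_norm_le_const_ae (a := 0) (b := 1) (f := deriv φ)
      (C := K * ‖v‖) (hder.mono fun t ht _ => ht)
    rw [hFTC] at h3
    simp only [hφ, one_smul, zero_smul, add_zero, sub_zero, abs_one, mul_one] at h3
    rw [← map_sub, hl2] at h3
    simpa using h3
  -- The estimate is closed in the base point z and holds on a dense set, hence everywhere.
  have hclosed : IsClosed {z | ‖g (z + v) - g z‖ ≤ K * ‖v‖} := by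
    refine isClosed_le ?_ continuous_const
    have := hg.continuous
    fun_prop
  have hdense : Dense {z | ‖g (z + v) - g z‖ ≤ K * ‖v‖} := Measure.dense_of_ae key
  have huniv := hclosed.closure_eq ▸ hdense.closure_eq
  have hy : y ∈ {z | ‖g (z + v) - g z‖ ≤ K * ‖v‖} := huniv ▸ mem_univ y
  have hyv : y + v = x := by rw [hv]; abel
  rw [mem_ofPred_eq, hyv] at hy
  exact hy

lemma contDiff_det {F : Type*} [NormedAddCommGroup F] [NormedSpace ℝ F] [FiniteDimensional ℝ F]
    {k : WithTop ℕ∞} : ContDiff ℝ k fun A : F →L[ℝ] F => A.det := by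
  have h : (fun A : F →L[ℝ] F => A.det) = fun A : F →L[ℝ] F =>
      (LinearMap.toMatrix (finBasis ℝ F) (finBasis ℝ F) (A : F →ₗ[ℝ] F)).det := by
    ext A
    rw [LinearMap.det_toMatrix]
  rw [h]
  simp only [Matrix.det_apply]
  refine ContDiff.sum fun σ _ => ContDiff.const_smul _ (contDiff_prod fun i _ => ?_)
  simp only [LinearMap.toMatrix_apply]
  have e : (fun A : F →L[ℝ] F => ((finBasis ℝ F).repr ((A : F →ₗ[ℝ] F) (finBasis ℝ F i))) (σ i)) =
      fun A : F →L[ℝ] F =>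
        (LinearMap.toContinuousLinearMap ((finBasis ℝ F).coord (σ i))) (A (finBasis ℝ F i)) := rfl
  rw [e]
  exact (ContinuousLinearMap.contDiff _).comp (contDiff_id.clm_apply contDiff_const)

/-- The determinant is a smooth function on a compact convex ball of operators. -/
lemma exists_abs_det_bounds {F : Type*} [NormedAddCommGroup F] [NormedSpace ℝ F]
    [FiniteDimensional ℝ F] (M : ℝ) :
    ∃ L : ℝ, 0 ≤ L ∧ (∀ A : F →L[ℝ] F, ‖A‖ ≤ M → |A.det| ≤ L) ∧
      ∀ A B : F →L[ℝ] F, ‖A‖ ≤ M → ‖B‖ ≤ M → |(|A.det| - |B.det|)| ≤ L * ‖A - B‖ := by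
  have hc : IsCompact (Metric.closedBall (0 : F →L[ℝ] F) M) := isCompact_closedBall _ _
  obtain ⟨L1, hL1⟩ := (contDiff_det (F := F) (k := 1)).contDiffOn.exists_lipschitzOnWith
    one_ne_zero (convex_closedBall 0 M) hc
  obtain ⟨L2, hL2⟩ := hc.exists_bound_of_continuousOn
    (contDiff_det (F := F) (k := 1)).continuous.continuousOn
  refine ⟨max L1 L2, le_max_of_le_left L1.2, fun A hA => ?_, fun A B hA hB => ?_⟩
  · exact (hL2 A (by simpa using hA)).trans (le_max_right _ _)
  · have h := hL1.dist_le_mul A (by simpa using hA) B (by simpa using hB)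
    rw [Real.dist_eq, dist_eq_norm] at h
    refine (abs_abs_sub_abs_le_abs_sub _ _).trans (h.trans ?_)
    gcongr
    exact le_max_left _ _

/-- Quantitative information on a `C^{1,1}` diffeomorphism that is the identity outside a ball. -/
structure IsTame {N : ℕ} (Φ : E N ≃ E N) (r M M' K : ℝ) : Prop where
  contDiff : ContDiff ℝ 1 Φ
  continuous_symm : Continuous Φ.symm
  norm_fderiv_le : ∀ x, ‖fderiv ℝ Φ x‖ ≤ M
  norm_sub_le : ∀ x y, ‖Φ x - Φ y‖ ≤ M * ‖x - y‖
  le_norm_sub : ∀ x y, ‖x - y‖ ≤ M' * ‖Φ x - Φ y‖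
  le_norm_fderiv : ∀ x h, ‖h‖ ≤ M' * ‖fderiv ℝ Φ x h‖
  norm_fderiv_sub_le : ∀ x y, ‖fderiv ℝ Φ x - fderiv ℝ Φ y‖ ≤ K * min ‖x - y‖ (8 * r)
  fixed : ∀ x, x ∉ Metric.ball 0 r → Φ x = x

lemma forall_norm_le_of_eLpNorm_top_le {F G : Type*} [NormedAddCommGroup F] [MeasurableSpace F]
    [NormedAddCommGroup G] {μ : Measure F} [μ.IsOpenPosMeasure] {g : F → G} (hg : Continuous g)
    {M : ℝ≥0} (h : eLpNorm g ∞ μ ≤ M) (x : F) : ‖g x‖ ≤ M := by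
  have hae : ∀ᵐ x ∂μ, ‖g x‖ ≤ M := by
    filter_upwards [ae_le_eLpNormEssSup (f := g) (μ := μ)] with x hx
    rw [eLpNorm_exponent_top] at h
    have := hx.trans h
    rw [enorm_eq_nnnorm] at this
    exact_mod_cast this
  have hclosed : IsClosed {x | ‖g x‖ ≤ M} := isClosed_le hg.norm continuous_const
  have hdense : Dense {x | ‖g x‖ ≤ M} := Measure.dense_of_ae hae
  have huniv := hclosed.closure_eq ▸ hdense.closure_eq
  have hx : x ∈ {x | ‖g x‖ ≤ M} := huniv ▸ mem_univ x
  exact hx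

lemma eLpNorm_fderiv_top_le {F G : Type*} [NormedAddCommGroup F] [NormedSpace ℝ F]
    [MeasurableSpace F] [NormedAddCommGroup G] [NormedSpace ℝ G] {g : F → G} {L : ℝ≥0}
    (hg : LipschitzWith L g) (μ : Measure F) : eLpNorm (fderiv ℝ g) ∞ μ ≤ L := by
  rw [eLpNorm_exponent_top]
  refine eLpNormEssSup_le_of_ae_nnnorm_bound (Eventually.of_forall fun x => ?_)
  exact norm_fderiv_le_of_lipschitz ℝ hg

lemma ae_norm_le_toReal_eLpNorm_top {F G : Type*} [MeasurableSpace F] [NormedAddCommGroup G]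
    {g : F → G} {μ : Measure F} (h : eLpNorm g ∞ μ ≠ ∞) :
    ∀ᵐ x ∂μ, ‖g x‖ ≤ (eLpNorm g ∞ μ).toReal := by
  rw [eLpNorm_exponent_top] at h ⊢
  filter_upwards [ae_le_eLpNormEssSup (f := g) (μ := μ)] with x hx
  simpa using ENNReal.toReal_mono h hx

/-- Adding 1 to M and M' keeps the constants positive. The Lipschitz constant K of DΦ is ‖D²Φ‖_∞
itself, so the final estimate is linear in it. -/
lemma isTame_of_supD_le {N : ℕ} (hN : 1 ≤ N) {Φ : E N ≃ E N} {M M' : ℝ≥0} {r : ℝ} (hr : 0 < r)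
    (hΦ : IsC11Diffeo Φ) (hfix : ∀ x, x ∉ Metric.ball 0 r → Φ x = x)
    (hM : supD Φ ≤ M) (hM' : supD Φ.symm ≤ M') :
    supD2 Φ ≠ ∞ ∧ IsTame Φ r (M + 1) (M' + 1) (supD2 Φ).toReal := by
  obtain ⟨⟨hC, L, hL⟩, hC', L', hL'⟩ := hΦ
  have : Nontrivial (E N) := by
    have : Nonempty (Fin N) := ⟨⟨0, hN⟩⟩
    infer_instance
  have hd : ∀ x, ‖fderiv ℝ Φ x‖ ≤ M :=
    forall_norm_le_of_eLpNorm_top_le (hC.continuous_fderiv one_ne_zero) hM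
  have hd' : ∀ x, ‖fderiv ℝ Φ.symm x‖ ≤ M' :=
    forall_norm_le_of_eLpNorm_top_le (hC'.continuous_fderiv one_ne_zero) hM'
  have hdiff : Differentiable ℝ Φ := hC.differentiable one_ne_zero
  have hdiff' : Differentiable ℝ Φ.symm := hC'.differentiable one_ne_zero
  have hlip : ∀ x y, ‖Φ x - Φ y‖ ≤ M * ‖x - y‖ := fun x y =>
    convex_univ.norm_image_sub_le_of_norm_fderiv_le (fun z _ => hdiff z) (fun z _ => hd z)
      (mem_univ y) (mem_univ x)
  have hlip' : ∀ x y, ‖Φ.symm x - Φ.symm y‖ ≤ M' * ‖x - y‖ := fun x y =>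
    convex_univ.norm_image_sub_le_of_norm_fderiv_le (fun z _ => hdiff' z) (fun z _ => hd' z)
      (mem_univ y) (mem_univ x)
  have htop : supD2 Φ ≠ ∞ := by
    exact ne_top_of_le_ne_top ENNReal.coe_ne_top (eLpNorm_fderiv_top_le hL volume)
  have hK : ∀ x y, ‖fderiv ℝ Φ x - fderiv ℝ Φ y‖ ≤ (supD2 Φ).toReal * ‖x - y‖ := by
    exact norm_sub_le_of_ae_norm_fderiv_le volume hL (ae_norm_le_toReal_eLpNorm_top htop)
  have hid : ∀ x, r < ‖x‖ → fderiv ℝ Φ x = ContinuousLinearMap.id ℝ (E N) := by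
    intro x hx
    have : (Φ : E N → E N) =ᶠ[𝓝 x] id := by
      filter_upwards [(isOpen_lt continuous_const continuous_norm).mem_nhds hx] with z hz
      exact hfix z (by simpa using le_of_lt hz)
    rw [this.fderiv_eq, fderiv_id]
  have hI : ∀ x, ‖fderiv ℝ Φ x - ContinuousLinearMap.id ℝ (E N)‖ ≤ (supD2 Φ).toReal * (4 * r) := by
    intro x
    rcases lt_or_ge r ‖x‖ with hx | hx
    · rw [hid x hx, sub_self, norm_zero]
      positivity
    -- A shift of length 4r leaves the closed ball of radius r, where DΦ is the identity. Hence DΦ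
    -- is within 4rK of the identity everywhere, and any two of its values are within 8rK.
    · obtain ⟨z, hz⟩ := exists_norm_eq (E N) (show 0 ≤ 4 * r by positivity)
      have h1 : r < ‖x + z‖ := by
        have := norm_sub_le (x + z) x
        rw [add_sub_cancel_left, hz] at this
        linarith
      have h2 := hK x (x + z)
      rwa [hid _ h1, sub_add_cancel_left, norm_neg, hz] at h2
  refine ⟨htop, hC, hC'.continuous, fun x => (hd x).trans (by simp), fun x y => (hlip x y).trans ?_,
    fun x y => ?_, fun x h => ?_, fun x y => ?_, hfix⟩
  · gcongr
    simp
  · have := hlip' (Φ x) (Φ y)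
    rw [Φ.symm_apply_apply, Φ.symm_apply_apply] at this
    refine this.trans ?_
    gcongr
    simp
  · have hcomp : fderiv ℝ (Φ.symm ∘ Φ) x = (fderiv ℝ Φ.symm (Φ x)).comp (fderiv ℝ Φ x) :=
      fderiv_comp x (hdiff' _) (hdiff _)
    rw [Φ.symm_comp_self, fderiv_id] at hcomp
    have h1 : h = fderiv ℝ Φ.symm (Φ x) (fderiv ℝ Φ x h) := congrArg (fun A => A h) hcomp
    calc ‖h‖ = ‖fderiv ℝ Φ.symm (Φ x) (fderiv ℝ Φ x h)‖ := by rw [← h1]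
      _ ≤ ‖fderiv ℝ Φ.symm (Φ x)‖ * ‖fderiv ℝ Φ x h‖ := ContinuousLinearMap.le_opNorm _ _
      _ ≤ _ := by
        gcongr
        exact (hd' _).trans (by simp)
  · rw [mul_min_of_nonneg _ _ ENNReal.toReal_nonneg]
    refine le_min (hK x y) ?_
    calc _ = ‖(fderiv ℝ Φ x - ContinuousLinearMap.id ℝ (E N)) -
          (fderiv ℝ Φ y - ContinuousLinearMap.id ℝ (E N))‖ := by rw [sub_sub_sub_cancel_right]
      _ ≤ _ := norm_sub_le _ _
      _ ≤ _ := by linarith [hI x, hI y]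

/-! ### The error of the frozen kernel -/

lemma abs_rpow_neg_sub_le {q l x y : ℝ} (hq : 0 < q) (hl : 0 < l) (hx : l ≤ x) (hy : l ≤ y) :
    |x ^ (-q) - y ^ (-q)| ≤ q * l ^ (-q - 1) * |x - y| := by
  refine (convex_Ici l).norm_image_sub_le_of_norm_hasDerivWithin_le (𝕜 := ℝ)
    (f := fun x : ℝ => x ^ (-q)) (f' := fun x => -q * x ^ (-q - 1)) (fun z hz => ?_)
    (fun z hz => ?_) hy hx
  · exact (Real.hasDerivAt_rpow_const (Or.inl (hl.trans_le hz).ne')).hasDerivWithinAt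
  · have hz : l ≤ z := hz
    have h0 : 0 < z := hl.trans_le hz
    rw [norm_mul, norm_neg, Real.norm_of_nonneg hq.le,
      Real.norm_of_nonneg (Real.rpow_nonneg h0.le _)]
    gcongr ?_ * ?_
    exact Real.rpow_le_rpow_of_nonpos hl hz (by linarith)

/-- The difference between the kernel transported by `Φ` and its frozen coefficient version. -/
noncomputable def kernelDiff {N : ℕ} (a : ℝ) (Φ : E N → E N) (w z : E N) : ℝ :=
  |(fderiv ℝ Φ z).det| * ‖Φ w - Φ z‖ ^ (-(N : ℝ) - a) -
    |(fderiv ℝ Φ w).det| * ‖fderiv ℝ Φ w (w - z)‖ ^ (-(N : ℝ) - a)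

namespace IsTame

variable {N : ℕ} {Φ : E N ≃ E N} {r M M' K : ℝ}

lemma continuous (h : IsTame Φ r M M' K) : Continuous Φ := h.contDiff.continuous

lemma continuous_fderiv (h : IsTame Φ r M M' K) : Continuous (fderiv ℝ Φ) :=
  h.contDiff.continuous_fderiv one_ne_zero

lemma continuous_abs_det (h : IsTame Φ r M M' K) :
    Continuous fun x => |(fderiv ℝ Φ x).det| :=
  ((contDiff_det (k := 1)).continuous.comp h.continuous_fderiv).abs

lemma hasFDerivAt (h : IsTame Φ r M M' K) (x : E N) : HasFDerivAt Φ (fderiv ℝ Φ x) x :=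
  (h.contDiff.differentiable one_ne_zero x).hasFDerivAt

lemma integral_comp (h : IsTame Φ r M M' K) (g : E N → ℝ) :
    ∫ y, g y = ∫ z, |(fderiv ℝ Φ z).det| * g (Φ z) := by
  have := integral_image_eq_integral_abs_det_fderiv_smul volume MeasurableSet.univ
    (fun x _ => (h.hasFDerivAt x).hasFDerivWithinAt) (Φ.injective.injOn (s := univ)) g
  rw [image_univ, Φ.surjective.range_eq] at this
  simpa using this

lemma lintegral_comp (h : IsTame Φ r M M' K) (S : Set (E N)) (hS : MeasurableSet S)
    (g : E N → ℝ≥0∞) :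
    ∫⁻ y in Φ '' S, g y = ∫⁻ z in S, ENNReal.ofReal |(fderiv ℝ Φ z).det| * g (Φ z) :=
  lintegral_image_eq_lintegral_abs_det_fderiv_mul volume hS
    (fun x _ => (h.hasFDerivAt x).hasFDerivWithinAt) Φ.injective.injOn g

/-- Mean value inequality for Φ minus its linear part at w, on the ball centred at w that reaches z.
-/
lemma norm_sub_sub_fderiv_le (h : IsTame Φ r M M' K) (hK : 0 ≤ K) (w z : E N) :
    ‖Φ w - Φ z - fderiv ℝ Φ w (w - z)‖ ≤ K * min ‖w - z‖ (8 * r) * ‖w - z‖ := by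
  have h1 := (convex_closedBall w ‖w - z‖).norm_image_sub_le_of_norm_fderiv_le' (𝕜 := ℝ) (f := Φ)
    (φ := fderiv ℝ Φ w) (C := K * min ‖w - z‖ (8 * r))
    (fun x _ => h.contDiff.differentiable one_ne_zero x) (fun x hx => ?_)
    (x := z) (y := w) (by simp [dist_eq_norm, norm_sub_rev]) (by simp)
  · exact h1
  · refine (h.norm_fderiv_sub_le x w).trans ?_
    gcongr
    simpa [dist_eq_norm] using hx

end IsTame

/-- Pointwise bound on the kernel difference, with a constant depending only on the `C^1` size. -/
lemma exists_abs_kernelDiff_le (N : ℕ) {a M M' : ℝ} (ha : 0 < a) (hM' : 0 < M') :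
    ∃ C : ℝ, 0 ≤ C ∧ ∀ (Φ : E N ≃ E N) (r K : ℝ), 0 < r → 0 ≤ K → IsTame Φ r M M' K →
      ∀ w z, |kernelDiff a Φ w z| ≤
        C * K * (min ‖w - z‖ (8 * r) * ‖w - z‖ ^ (-(N : ℝ) - a)) := by
  obtain ⟨L, hL0, hL1, hL2⟩ := exists_abs_det_bounds (F := E N) M
  set q : ℝ := (N : ℝ) + a with hq
  have hq0 : 0 < q := by positivity
  have hqe : -(N : ℝ) - a = -q := by rw [hq]; ring
  -- The first summand pays for replacing Φ(w) - Φ(z) by its linearization, the second for freezing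
  -- the determinant.
  refine ⟨L * (q * M' ^ (q + 1)) + L * M' ^ q, by positivity, ?_⟩
  intro Φ r K hr hK h w z
  unfold kernelDiff
  rw [hqe]
  rcases eq_or_ne w z with rfl | hwz
  -- On the diagonal both powers are 0 by the convention for negative powers of 0.
  · simp [Real.zero_rpow (neg_ne_zero.2 hq0.ne')]
  have hpos : 0 < ‖w - z‖ := norm_pos_iff.2 (sub_ne_zero.2 hwz)
  set d := ‖w - z‖ with hd
  have hl : 0 < d / M' := by positivity
  have h1 : d / M' ≤ ‖Φ w - Φ z‖ := by
    rw [div_le_iff₀' hM']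
    exact h.le_norm_sub w z
  have h2 : d / M' ≤ ‖fderiv ℝ Φ w (w - z)‖ := by
    rw [div_le_iff₀' hM']
    exact h.le_norm_fderiv w (w - z)
  set m := min d (8 * r) with hm
  have hm0 : 0 ≤ m := by positivity
  have h3 := abs_rpow_neg_sub_le hq0 hl h1 h2
  have h4 : |‖Φ w - Φ z‖ - ‖fderiv ℝ Φ w (w - z)‖| ≤ K * m * d :=
    (abs_norm_sub_norm_le _ _).trans (h.norm_sub_sub_fderiv_le hK w z)
  have h5 : ‖fderiv ℝ Φ w (w - z)‖ ^ (-q) ≤ (d / M') ^ (-q) :=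
    Real.rpow_le_rpow_of_nonpos hl h2 (by linarith)
  have h6 := hL2 _ _ (h.norm_fderiv_le z) (h.norm_fderiv_le w)
  have h7 : ‖fderiv ℝ Φ z - fderiv ℝ Φ w‖ ≤ K * m := by
    have := h.norm_fderiv_sub_le z w
    rwa [norm_sub_rev z w] at this
  have e1 : (d / M') ^ (-q) = M' ^ q * d ^ (-q) := by
    rw [Real.div_rpow hpos.le hM'.le, Real.rpow_neg hM'.le, div_inv_eq_mul, mul_comm]
  have e2 : (d / M') ^ (-q - 1) * d = M' ^ (q + 1) * d ^ (-q) := by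
    rw [Real.div_rpow hpos.le hM'.le, show -q - 1 = -(q + 1) by ring, Real.rpow_neg hM'.le,
      div_inv_eq_mul, mul_right_comm, ← Real.rpow_add_one hpos.ne', mul_comm]
    ring_nf
  calc _ = |(|(fderiv ℝ Φ z).det| * (‖Φ w - Φ z‖ ^ (-q) - ‖fderiv ℝ Φ w (w - z)‖ ^ (-q)) +
        (|(fderiv ℝ Φ z).det| - |(fderiv ℝ Φ w).det|) * ‖fderiv ℝ Φ w (w - z)‖ ^ (-q))| := by
        congr 1
        ring
    _ ≤ |(fderiv ℝ Φ z).det| * |‖Φ w - Φ z‖ ^ (-q) - ‖fderiv ℝ Φ w (w - z)‖ ^ (-q)| +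
        |(|(fderiv ℝ Φ z).det| - |(fderiv ℝ Φ w).det|)| * ‖fderiv ℝ Φ w (w - z)‖ ^ (-q) := by
        refine (abs_add_le _ _).trans (le_of_eq ?_)
        rw [abs_mul, abs_mul, abs_abs, abs_of_nonneg (Real.rpow_nonneg (norm_nonneg _) (-q))]
    _ ≤ L * (q * (d / M') ^ (-q - 1) * (K * m * d)) + L * (K * m) * (d / M') ^ (-q) := by
        gcongr
        · exact hL1 _ (h.norm_fderiv_le z)
        · exact h3.trans (by gcongr)
        · exact h6.trans (by gcongr)
    _ = L * q * K * m * ((d / M') ^ (-q - 1) * d) + L * (K * m) * (d / M') ^ (-q) := by ring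
    _ = _ := by
        rw [e1, e2]
        ring

lemma abs_lastCoord_sub_le {N : ℕ} (hN : 1 ≤ N) (x y : E N) :
    |lastCoord hN x - lastCoord hN y| ≤ ‖x - y‖ :=
  PiLp.norm_apply_le (x - y) _

lemma continuous_lastCoord {N : ℕ} (hN : 1 ≤ N) : Continuous (lastCoord hN) := by
  unfold lastCoord
  fun_prop

lemma nontrivial_E {N : ℕ} (hN : 1 ≤ N) : Nontrivial (E N) := by
  have : Nonempty (Fin N) := ⟨⟨0, hN⟩⟩
  infer_instance

lemma rpow_mul_rpow_neg {N : ℕ} {s p d : ℝ} (hd : 0 < d) :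
    d ^ (s * (p - 1)) * d ^ (-(N : ℝ) - p * s) = d ^ (-(N : ℝ) - s) := by
  rw [← Real.rpow_add hd]
  ring_nf

lemma abs_truncInt_mul_rpow_le {N : ℕ} {s p l a b d : ℝ} (hs0 : 0 < s) (hs1 : s < 1) (hp : 1 < p)
    (hl0 : 0 < l) (hl1 : l < 1) (ha : 0 < a) (hab : |a - b| ≤ d) :
    |truncInt s p l a b| * d ^ (-(N : ℝ) - p * s) ≤
      (Ici ((1 - l) * a)).indicator (fun d => d ^ (-(N : ℝ) - s)) d := by
  by_cases h : offDiag l a b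
  · have h1 := h.le_abs_sub hl0 hl1 ha
    have h2 : 0 < (1 - l) * a := mul_pos (by linarith) ha
    have hd : 0 < d := by linarith
    rw [indicator_of_mem (by exact h1.trans hab), ← rpow_mul_rpow_neg (N := N) (s := s) (p := p) hd]
    gcongr
    refine (abs_truncInt_le hs0 hs1 hp l a b).trans ?_
    exact Real.rpow_le_rpow (abs_nonneg _) hab (mul_nonneg hs0.le (by linarith))
  · rw [truncInt, indicator_of_notMem (by exact h), abs_zero, zero_mul]
    exact indicator_apply_nonneg fun _ => Real.rpow_nonneg ((abs_nonneg _).trans hab) _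

/-- If a ≠ b the pair is kept for l near 1; if a = b the integrand vanishes anyway. So the
truncation converges pointwise everywhere. -/
lemma eventually_truncInt_eq (s p a b : ℝ) :
    ∀ᶠ l in 𝓝[<] (1 : ℝ), truncInt s p l a b = spow (posPow s a - posPow s b) (p - 1) := by
  have key : ∀ a b : ℝ, a < b → ∀ᶠ l in 𝓝[<] (1 : ℝ), a ≤ l * b := by
    intro a b hab
    have : Tendsto (fun l : ℝ => l * b) (𝓝[<] 1) (𝓝 (1 * b)) :=
      ((continuous_id.mul continuous_const).tendsto 1).mono_left nhdsWithin_le_nhds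
    rw [one_mul] at this
    exact (this.eventually (lt_mem_nhds hab)).mono fun l hl => hl.le
  rcases lt_trichotomy a b with h | h | h
  · filter_upwards [key a b h] with l hl
    exact indicator_of_mem (show b ∈ {b | offDiag l a b} from Or.inr hl) _
  · subst h
    refine Eventually.of_forall fun l => ?_
    unfold truncInt indicator
    split_ifs <;> simp [spow_zero]
  · filter_upwards [key b a h] with l hl
    exact indicator_of_mem (show b ∈ {b | offDiag l a b} from Or.inl hl) _

/-- The truncated nonlocal operator applied to `x ↦ (Φ⁻¹(x)_N)_+^s`. -/
noncomputable def truncOp {N : ℕ} (hN : 1 ≤ N) (s p l : ℝ) (Φ : E N ≃ E N) (x : E N) : ℝ :=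
  ∫ y, truncInt s p l (lastCoord hN (Φ.symm x)) (lastCoord hN (Φ.symm y)) *
    ‖x - y‖ ^ (-(N : ℝ) - p * s)

/-- Half of the right-hand side, in the coordinates that flatten the boundary. -/
noncomputable def residual {N : ℕ} (hN : 1 ≤ N) (s p : ℝ) (Φ : E N ≃ E N) (w : E N) : ℝ :=
  ∫ z, spow (posPow s (lastCoord hN w) - posPow s (lastCoord hN z)) (p - 1) *
    kernelDiff (p * s) Φ w z

lemma measurable_kernelDiff {N : ℕ} {Φ : E N ≃ E N} {r M M' K : ℝ} (h : IsTame Φ r M M' K)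
    (a : ℝ) : Measurable fun q : E N × E N => kernelDiff a Φ q.1 q.2 := by
  unfold kernelDiff
  have h1 := h.continuous.measurable
  have h2 := h.continuous_abs_det.measurable
  have h3 : Measurable fun q : E N × E N => fderiv ℝ Φ q.1 (q.1 - q.2) :=
    ((h.continuous_fderiv.comp continuous_fst).clm_apply
      (continuous_fst.sub continuous_snd)).measurable
  exact ((h2.comp measurable_snd).mul (((h1.comp measurable_fst).sub
    (h1.comp measurable_snd)).norm.pow_const _)).sub
    ((h2.comp measurable_fst).mul (h3.norm.pow_const _))

lemma measurable_kernelDiff_right {N : ℕ} {Φ : E N ≃ E N} {r M M' K : ℝ} (h : IsTame Φ r M M' K)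
    (a : ℝ) (w : E N) : Measurable fun z => kernelDiff a Φ w z :=
  (measurable_kernelDiff h a).comp measurable_prodMk_left

lemma abs_mul_kernelDiff_le {N : ℕ} {s p C K r : ℝ} {t : ℝ} {w z : E N}
    {Φ : E N ≃ E N} (hr : 0 < r)
    (hC : |kernelDiff (p * s) Φ w z| ≤
        C * K * (min ‖w - z‖ (8 * r) * ‖w - z‖ ^ (-(N : ℝ) - p * s)))
    (ht : |t| ≤ ‖w - z‖ ^ (s * (p - 1))) :
    ‖t * kernelDiff (p * s) Φ w z‖ ≤
      C * K * (min ‖w - z‖ (8 * r) * ‖w - z‖ ^ (-(N : ℝ) - s)) := by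
  rw [norm_mul, Real.norm_eq_abs, Real.norm_eq_abs]
  rcases eq_or_ne w z with rfl | hwz
  · have : kernelDiff (p * s) Φ w w = 0 := by simp [kernelDiff]
    rw [this, abs_zero, mul_zero, sub_self, norm_zero, min_eq_left (by positivity), zero_mul,
      mul_zero]
  have hpos : 0 < ‖w - z‖ := norm_pos_iff.2 (sub_ne_zero.2 hwz)
  calc _ ≤ ‖w - z‖ ^ (s * (p - 1)) *
        (C * K * (min ‖w - z‖ (8 * r) * ‖w - z‖ ^ (-(N : ℝ) - p * s))) := by gcongr
    _ = C * K * (min ‖w - z‖ (8 * r) *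
        (‖w - z‖ ^ (s * (p - 1)) * ‖w - z‖ ^ (-(N : ℝ) - p * s))) := by ring
    _ = _ := by rw [rpow_mul_rpow_neg hpos]

/-- The truncated operator is bounded up to the natural boundary singularity, and converges to a
function that is controlled by the second derivatives of `Φ`. -/
lemma exists_truncOp_bounds {N : ℕ} (hN : 1 ≤ N) {s p : ℝ} (hs0 : 0 < s) (hs1 : s < 1)
    (hp : 1 < p) {r M M' : ℝ} (hr : 0 < r) (hM' : 0 < M') :
    ∃ C₁ C₂ : ℝ, 0 ≤ C₁ ∧ 0 ≤ C₂ ∧ ∀ (Φ : E N ≃ E N) (K : ℝ), 0 ≤ K → IsTame Φ r M M' K →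
      (∀ w, |residual hN s p Φ w| ≤ C₁ * K) ∧
      (∀ w, 0 < lastCoord hN w → ∀ l ∈ Ioo (0 : ℝ) 1,
        |truncOp hN s p l Φ (Φ w)| ≤ C₁ * K + C₂ * lastCoord hN w ^ (-s)) ∧
      ∀ w, 0 < lastCoord hN w →
        Tendsto (fun l => truncOp hN s p l Φ (Φ w)) (𝓝[<] 1) (𝓝 (residual hN s p Φ w)) := by
  have := nontrivial_E hN
  have hps : 0 < p * s := by positivity
  obtain ⟨C, hC0, hC⟩ := exists_abs_kernelDiff_le N (M := M) hps hM'
  obtain ⟨B, hB0, hB⟩ := exists_integral_lastCoord_mul_kernel hN hps (inv_pos.2 hM')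
  obtain ⟨L, hL0, hL, -⟩ := exists_abs_det_bounds (F := E N) M
  have hI := integrable_min_norm_mul_rpow (F := E N) volume hs0 hs1 (R := 8 * r) (by positivity)
  have hJ := fun R : ℝ => integrable_indicator_norm_rpow (F := E N) (s := s) (R := R) volume hs0
  simp only [finrank_euclideanSpace_fin] at hI hJ
  set I : ℝ := ∫ h : E N, min ‖h‖ (8 * r) * ‖h‖ ^ (-(N : ℝ) - s) with hIdef
  have hI0 : 0 ≤ I := integral_nonneg fun h => by positivity
  -- C * I comes from the kernel error. L * B bounds the determinant times the tangential integral,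
  -- and 1/(ps) bounds κ(l).
  refine ⟨C * I, L * B / (p * s), by positivity, by positivity, fun Φ K hK hΦ => ?_⟩
  have hdom : ∀ w : E N, Integrable fun z =>
      C * K * (min ‖w - z‖ (8 * r) * ‖w - z‖ ^ (-(N : ℝ) - s)) := fun w =>
    (hI.comp_sub_left w).const_mul _
  have hdomI : ∀ w : E N, ∫ z, C * K * (min ‖w - z‖ (8 * r) * ‖w - z‖ ^ (-(N : ℝ) - s)) =
      C * I * K := fun w => by
    rw [integral_const_mul, integral_sub_left_eq_self (fun h : E N =>
      min ‖h‖ (8 * r) * ‖h‖ ^ (-(N : ℝ) - s)) volume w, ← hIdef]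
    ring
  have hpow : ∀ w z : E N, |lastCoord hN w - lastCoord hN z| ^ (s * (p - 1)) ≤
      ‖w - z‖ ^ (s * (p - 1)) := fun w z =>
    Real.rpow_le_rpow (abs_nonneg _) (abs_lastCoord_sub_le hN w z)
      (mul_nonneg hs0.le (by linarith))
  have hres : ∀ w z : E N, ‖spow (posPow s (lastCoord hN w) - posPow s (lastCoord hN z)) (p - 1) *
      kernelDiff (p * s) Φ w z‖ ≤ C * K * (min ‖w - z‖ (8 * r) * ‖w - z‖ ^ (-(N : ℝ) - s)) :=
    fun w z => abs_mul_kernelDiff_le hr (hC Φ r K hr hK hΦ w z)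
      ((abs_spow_posPow_sub_le hs0 hs1 hp _ _).trans (hpow w z))
  have htr : ∀ (l : ℝ) (w z : E N), ‖truncInt s p l (lastCoord hN w) (lastCoord hN z) *
      kernelDiff (p * s) Φ w z‖ ≤ C * K * (min ‖w - z‖ (8 * r) * ‖w - z‖ ^ (-(N : ℝ) - s)) :=
    fun l w z => abs_mul_kernelDiff_le hr (hC Φ r K hr hK hΦ w z)
      ((abs_truncInt_le hs0 hs1 hp l _ _).trans (hpow w z))
  have hmeas : ∀ (l : ℝ) (w : E N), Measurable fun z =>
      truncInt s p l (lastCoord hN w) (lastCoord hN z) := fun l w =>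
    (measurable_truncInt hs0 p l _).comp (continuous_lastCoord hN).measurable
  have hkd : ∀ w : E N, Measurable fun z => kernelDiff (p * s) Φ w z :=
    measurable_kernelDiff_right hΦ _
  have htrint : ∀ (l : ℝ) (w : E N), Integrable fun z =>
      truncInt s p l (lastCoord hN w) (lastCoord hN z) * kernelDiff (p * s) Φ w z := fun l w =>
    (hdom w).mono' ((hmeas l w).mul (hkd w)).aestronglyMeasurable
      (Eventually.of_forall fun z => htr l w z)
  -- After y = Φ(z), the truncated operator splits into the kernel error and the frozen part, and
  -- the latter is computed exactly.
  have hdecomp : ∀ w, 0 < lastCoord hN w → ∀ l ∈ Ioo (0 : ℝ) 1, ∃ c : ℝ, |c| ≤ L * B ∧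
      truncOp hN s p l Φ (Φ w) =
        (∫ z, truncInt s p l (lastCoord hN w) (lastCoord hN z) * kernelDiff (p * s) Φ w z) +
        c * (lastCoord hN w ^ (-s) *
          ((1 - l ^ s) ^ p * (1 - l) ^ (-(p * s)) / (p * s))) := by
    intro w hw l hl
    obtain ⟨cA, hcA, hcA'⟩ := hB (fderiv ℝ Φ w) fun h => by
      rw [inv_mul_le_iff₀ hM']
      exact hΦ.le_norm_fderiv w h
    refine ⟨|(fderiv ℝ Φ w).det| * cA, ?_, ?_⟩
    · rw [abs_mul, abs_abs]
      gcongr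
      exact hL _ (hΦ.norm_fderiv_le w)
    have hfro : Integrable fun h : E N =>
        truncInt s p l (lastCoord hN w) (lastCoord hN w - lastCoord hN h) *
          ‖fderiv ℝ Φ w h‖ ^ (-(N : ℝ) - p * s) := by
      refine ((hJ ((1 - l) * lastCoord hN w) (mul_pos (by linarith [hl.2]) hw)).const_mul
        (M' ^ ((N : ℝ) + p * s))).mono' ?_ (Eventually.of_forall fun h => ?_)
      · refine Measurable.aestronglyMeasurable (Measurable.mul ?_ (by fun_prop))
        exact (measurable_truncInt hs0 p l _).comp
          (measurable_const.sub (continuous_lastCoord hN).measurable)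
      · have h1 := abs_truncInt_mul_rpow_le (N := N) hs0 hs1 hp hl.1 hl.2 hw
          (b := lastCoord hN w - lastCoord hN h) (d := ‖h‖) (by
            rw [sub_sub_cancel]
            exact PiLp.norm_apply_le h _)
        rw [norm_mul, Real.norm_eq_abs, Real.norm_of_nonneg (by positivity)]
        have h2 : ‖fderiv ℝ Φ w h‖ ^ (-(N : ℝ) - p * s) ≤
            M' ^ ((N : ℝ) + p * s) * ‖h‖ ^ (-(N : ℝ) - p * s) := by
          rcases eq_or_ne h 0 with rfl | hh
          · have : -(N : ℝ) - p * s ≠ 0 := by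
              have : (0 : ℝ) ≤ N := Nat.cast_nonneg _
              linarith
            simp [Real.zero_rpow this]
          · have hpos : 0 < ‖h‖ := norm_pos_iff.2 hh
            have h3 : ‖h‖ / M' ≤ ‖fderiv ℝ Φ w h‖ := by
              rw [div_le_iff₀' hM']
              exact hΦ.le_norm_fderiv w h
            have hN0 : (0 : ℝ) ≤ N := Nat.cast_nonneg _
            refine (Real.rpow_le_rpow_of_nonpos (by positivity) h3 (by linarith)).trans
              (le_of_eq ?_)
            rw [Real.div_rpow hpos.le hM'.le, show -(N : ℝ) - p * s = -((N : ℝ) + p * s) by ring,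
              Real.rpow_neg hM'.le, div_inv_eq_mul, mul_comm]
        calc _ ≤ |truncInt s p l (lastCoord hN w) (lastCoord hN w - lastCoord hN h)| *
              (M' ^ ((N : ℝ) + p * s) * ‖h‖ ^ (-(N : ℝ) - p * s)) := by gcongr
          _ = M' ^ ((N : ℝ) + p * s) * (|truncInt s p l (lastCoord hN w)
              (lastCoord hN w - lastCoord hN h)| * ‖h‖ ^ (-(N : ℝ) - p * s)) := by ring
          _ ≤ _ := by gcongr; exact h1
    have hcA'' := hcA' (fun t => truncInt s p l (lastCoord hN w) (lastCoord hN w - t)) hfro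
    rw [integral_truncInt_sub hs0 hs1 hp hl.1 hl.2 hw] at hcA''
    have hlin : ∀ h : E N, lastCoord hN (w - h) = lastCoord hN w - lastCoord hN h := fun h => rfl
    have hfro' : ∀ z : E N, truncInt s p l (lastCoord hN w) (lastCoord hN w -
        lastCoord hN (w - z)) * ‖fderiv ℝ Φ w (w - z)‖ ^ (-(N : ℝ) - p * s) =
        truncInt s p l (lastCoord hN w) (lastCoord hN z) *
          ‖fderiv ℝ Φ w (w - z)‖ ^ (-(N : ℝ) - p * s) := fun z => by
      rw [hlin, sub_sub_cancel]
    have hfi := hfro.comp_sub_left w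
    rw [← integral_sub_left_eq_self _ volume w] at hcA''
    simp_rw [hfro'] at hfi hcA''
    rw [mul_assoc, ← hcA'', ← integral_const_mul, ← integral_add (htrint l w) (hfi.const_mul _),
      truncOp, hΦ.integral_comp]
    refine integral_congr_ae (Eventually.of_forall fun z => ?_)
    simp only [Equiv.symm_apply_apply, kernelDiff]
    ring
  refine ⟨fun w => ?_, fun w hw l hl => ?_, fun w hw => ?_⟩
  · rw [← hdomI w, residual]
    exact norm_integral_le_of_norm_le (hdom w) (Eventually.of_forall fun z => hres w z)
  · obtain ⟨c, hc, hce⟩ := hdecomp w hw l hl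
    have h1 := norm_integral_le_of_norm_le (hdom w) (Eventually.of_forall fun z => htr l w z)
    rw [hdomI w, Real.norm_eq_abs] at h1
    rw [hce]
    refine (abs_add_le _ _).trans (add_le_add h1 ?_)
    have h2 := integral_truncInt_one_nonneg hs0 hp hl.1 hl.2
    have h3 := integral_truncInt_one_le_inv hs0 hs1 hp hl.1 hl.2
    have h4 := Real.rpow_nonneg hw.le (-s)
    rw [abs_mul, abs_of_nonneg (mul_nonneg h4 h2)]
    calc _ ≤ L * B * (lastCoord hN w ^ (-s) * (1 / (p * s))) := by gcongr
      _ = _ := by ring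
  · have hmem : ∀ᶠ l : ℝ in 𝓝[<] 1, l ∈ Ioo (0 : ℝ) 1 := Ioo_mem_nhdsLT one_pos
    have hlim : Tendsto (fun l => ∫ z, truncInt s p l (lastCoord hN w) (lastCoord hN z) *
        kernelDiff (p * s) Φ w z) (𝓝[<] 1) (𝓝 (residual hN s p Φ w)) := by
      refine tendsto_integral_filter_of_dominated_convergence _
        (Eventually.of_forall fun l => (htrint l w).aestronglyMeasurable)
        (Eventually.of_forall fun l => Eventually.of_forall fun z => htr l w z) (hdom w)
        (Eventually.of_forall fun z => ?_)
      refine Tendsto.mul_const _ (tendsto_const_nhds.congr' ?_)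
      filter_upwards [eventually_truncInt_eq s p (lastCoord hN w) (lastCoord hN z)] with l hl
      exact hl.symm
    -- For fixed w, the frozen part is at most a constant times κ(l), so it disappears in the limit.
    have hzero : Tendsto (fun l => truncOp hN s p l Φ (Φ w) - ∫ z, truncInt s p l (lastCoord hN w)
        (lastCoord hN z) * kernelDiff (p * s) Φ w z) (𝓝[<] 1) (𝓝 0) := by
      have h0 := (tendsto_integral_truncInt_one hs0 hs1 hp).const_mul
        (L * B * lastCoord hN w ^ (-s))
      rw [mul_zero] at h0
      refine squeeze_zero_norm' ?_ h0
      filter_upwards [hmem] with l hl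
      obtain ⟨c, hc, hce⟩ := hdecomp w hw l hl
      have h2 := integral_truncInt_one_nonneg hs0 hp hl.1 hl.2
      have h4 := Real.rpow_nonneg hw.le (-s)
      rw [hce, add_sub_cancel_left, norm_mul, Real.norm_eq_abs,
        Real.norm_of_nonneg (mul_nonneg h4 h2), mul_assoc]
      gcongr
    simpa using hzero.add hlim

/-! ### The function v belongs to the energy space -/

/-- This is the integrand of a convolution of two integrable functions. -/
lemma integrable_snd_mul_norm_sub {N : ℕ} {f : E N → ℝ} {k : ℝ → ℝ} (hf : Integrable f)
    (hk : Integrable fun h : E N => k ‖h‖) :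
    Integrable fun z : E N × E N => f z.2 * k ‖z.1 - z.2‖ := by
  have := hf.convolution_integrand (ContinuousLinearMap.mul ℝ ℝ) hk
  simpa [Measure.volume_eq_prod] using this

lemma integrable_fst_mul_norm_sub {N : ℕ} {f : E N → ℝ} {k : ℝ → ℝ} (hf : Integrable f)
    (hk : Integrable fun h : E N => k ‖h‖) :
    Integrable fun z : E N × E N => f z.1 * k ‖z.1 - z.2‖ := by
  have := (integrable_snd_mul_norm_sub hf hk).swap
  rw [Measure.volume_eq_prod]
  simpa [Function.comp_def, norm_sub_rev] using this

/-- The function `x ↦ (Φ⁻¹(x)_N)_+^s`. -/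
noncomputable def pullback {N : ℕ} (hN : 1 ≤ N) (s : ℝ) (Φ : E N ≃ E N) (x : E N) : ℝ :=
  posPow s (lastCoord hN (Φ.symm x))

lemma gagliardo_nonneg {N : ℕ} (s p : ℝ) (u : E N → ℝ) (z : E N × E N) : 0 ≤ gagliardo s p u z := by
  unfold gagliardo
  positivity

lemma aestronglyMeasurable_gagliardo {N : ℕ} (s p : ℝ) {u : E N → ℝ}
    (hu : AEStronglyMeasurable u volume) :
    AEStronglyMeasurable (gagliardo s p u) volume := by
  unfold gagliardo
  have h1 : AEStronglyMeasurable (fun z : E N × E N => u z.1) volume := hu.comp_fst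
  have h2 : AEStronglyMeasurable (fun z : E N × E N => u z.2) volume := hu.comp_snd
  have h3 := (h1.aemeasurable.sub h2.aemeasurable).abs.pow_const p
  exact (h3.div (by fun_prop : Measurable fun z : E N × E N =>
    ‖z.1 - z.2‖ ^ ((N : ℝ) + p * s)).aemeasurable).aestronglyMeasurable

namespace IsTame

variable {N : ℕ} {Φ : E N ≃ E N} {r M M' K : ℝ}

lemma norm_symm_sub_le (h : IsTame Φ r M M' K) (x y : E N) :
    ‖Φ.symm x - Φ.symm y‖ ≤ M' * ‖x - y‖ := by
  simpa using h.le_norm_sub (Φ.symm x) (Φ.symm y)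

lemma abs_lastCoord_symm_sub_le (h : IsTame Φ r M M' K) (hN : 1 ≤ N) (x y : E N) :
    |lastCoord hN (Φ.symm x) - lastCoord hN (Φ.symm y)| ≤ M' * ‖x - y‖ :=
  (abs_lastCoord_sub_le hN _ _).trans (h.norm_symm_sub_le x y)

lemma continuous_lastCoord_symm (h : IsTame Φ r M M' K) (hN : 1 ≤ N) :
    Continuous fun x => lastCoord hN (Φ.symm x) :=
  (continuous_lastCoord hN).comp h.continuous_symm

lemma continuous_pullback (h : IsTame Φ r M M' K) (hN : 1 ≤ N) {s : ℝ} (hs0 : 0 < s) :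
    Continuous (pullback hN s Φ) :=
  (continuous_posPow hs0.le).comp (h.continuous_lastCoord_symm hN)

lemma integrableOn_abs_lastCoord_symm_rpow (h : IsTame Φ r M M' K) (hN : 1 ≤ N) (hM' : 0 < M')
    {b : ℝ} (hb : -1 < b) (R : ℝ) :
    IntegrableOn (fun x => |lastCoord hN (Φ.symm x)| ^ b) (Metric.ball 0 R) := by
  have hm : Measurable fun x => |lastCoord hN (Φ.symm x)| ^ b :=
    (h.continuous_lastCoord_symm hN).measurable.abs.pow_const b
  refine ⟨hm.aestronglyMeasurable, ?_⟩
  rw [hasFiniteIntegral_iff_ofReal (Eventually.of_forall fun x => by positivity)]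
  obtain ⟨L, hL0, hL, -⟩ := exists_abs_det_bounds (F := E N) M
  have himg : Φ '' (Φ ⁻¹' Metric.ball 0 R) = Metric.ball 0 R :=
    image_preimage_eq _ Φ.surjective
  have hmS : MeasurableSet (Φ ⁻¹' Metric.ball 0 R) :=
    h.continuous.measurable measurableSet_ball
  have hsub : Φ ⁻¹' Metric.ball 0 R ⊆ Metric.ball 0 (‖Φ.symm 0‖ + M' * R + 1) := by
    intro z hz
    have hz : ‖Φ z‖ < R := by simpa using hz
    have h1 := h.norm_symm_sub_le (Φ z) 0
    rw [Φ.symm_apply_apply, sub_zero] at h1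
    have h2 := norm_sub_norm_le z (Φ.symm 0)
    have h3 : M' * ‖Φ z‖ ≤ M' * R := by gcongr
    simp only [mem_ball_zero_iff]
    linarith
  rw [← himg, h.lintegral_comp _ hmS]
  calc _ ≤ ∫⁻ z in Φ ⁻¹' Metric.ball 0 R,
        ENNReal.ofReal L * ENNReal.ofReal (|lastCoord hN z| ^ b) := by
        refine lintegral_mono fun z => ?_
        simp only [Φ.symm_apply_apply]
        gcongr
        exact hL _ (h.norm_fderiv_le z)
    _ ≤ ∫⁻ z in Metric.ball 0 (‖Φ.symm 0‖ + M' * R + 1),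
        ENNReal.ofReal L * ENNReal.ofReal (|lastCoord hN z| ^ b) := lintegral_mono_set hsub
    _ < ∞ := by
        rw [lintegral_const_mul' _ _ ENNReal.ofReal_ne_top]
        exact ENNReal.mul_lt_top ENNReal.ofReal_lt_top
          (lintegral_ball_abs_lastCoord_rpow_lt_top hN hb _)

lemma abs_pullback_sub_le (h : IsTame Φ r M M' K) (hN : 1 ≤ N) {s : ℝ} (hs0 : 0 < s)
    (hs1 : s < 1) (x y : E N) :
    |pullback hN s Φ x - pullback hN s Φ y| ≤ (M' * ‖x - y‖) ^ s :=
  (abs_posPow_sub_le hs0 hs1 _ _).trans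
    (Real.rpow_le_rpow (abs_nonneg _) (h.abs_lastCoord_symm_sub_le hN x y) hs0.le)

lemma gagliardo_pullback_le (h : IsTame Φ r M M' K) (hN : 1 ≤ N) (hM' : 0 < M') {s p : ℝ}
    (hs0 : 0 < s) (hs1 : s < 1) (hp : 1 < p) (z : E N × E N) :
    gagliardo s p (pullback hN s Φ) z ≤ M' ^ (s * p + (1 - s)) *
      (|lastCoord hN (Φ.symm z.1)| ^ (s - 1) * ‖z.1 - z.2‖ ^ (-(N : ℝ) + (1 - s)) +
        |lastCoord hN (Φ.symm z.2)| ^ (s - 1) * ‖z.1 - z.2‖ ^ (-(N : ℝ) + (1 - s))) := by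
  obtain ⟨x, y⟩ := z
  rcases eq_or_ne x y with rfl | hxy
  · have h0 : gagliardo s p (pullback hN s Φ) (x, x) = 0 := by
      simp [gagliardo, Real.zero_rpow (show p ≠ 0 by linarith)]
    rw [h0]
    positivity
  have hpos : 0 < ‖x - y‖ := norm_pos_iff.2 (sub_ne_zero.2 hxy)
  have h1 := abs_posPow_sub_rpow_le hs0 hs1 hp (lastCoord hN (Φ.symm x)) (lastCoord hN (Φ.symm y))
  have hexp : 0 ≤ s * p + (1 - s) := by nlinarith
  have h2 := Real.rpow_le_rpow (abs_nonneg _) (h.abs_lastCoord_symm_sub_le hN x y) hexp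
  rw [Real.mul_rpow hM'.le hpos.le] at h2
  unfold gagliardo pullback
  simp only
  rw [div_le_iff₀ (by positivity)]
  refine h1.trans ?_
  have e : ‖x - y‖ ^ (-(N : ℝ) + (1 - s)) * ‖x - y‖ ^ ((N : ℝ) + p * s) =
      ‖x - y‖ ^ (s * p + (1 - s)) := by
    rw [← Real.rpow_add hpos]
    ring_nf
  calc _ ≤ M' ^ (s * p + (1 - s)) * ‖x - y‖ ^ (s * p + (1 - s)) *
        (|lastCoord hN (Φ.symm x)| ^ (s - 1) + |lastCoord hN (Φ.symm y)| ^ (s - 1)) := by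
        gcongr
    _ = _ := by
        rw [← e]
        ring

lemma integrableOn_gagliardo_pullback (h : IsTame Φ r M M' K) (hN : 1 ≤ N) (hM' : 0 < M')
    {s p : ℝ} (hs0 : 0 < s) (hs1 : s < 1) (hp : 1 < p) (R : ℝ) :
    IntegrableOn (gagliardo s p (pullback hN s Φ)) (Metric.ball 0 R ×ˢ Metric.ball 0 R) := by
  have := nontrivial_E hN
  set B : Set (E N) := Metric.ball 0 R with hB
  set g : E N → ℝ := B.indicator fun x => |lastCoord hN (Φ.symm x)| ^ (s - 1) with hg
  -- Two points of the ball are closer than 2R, so the kernel may be cut off there and becomes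
  -- integrable.
  set k : ℝ → ℝ := (Iio (2 * R)).indicator fun d => d ^ (-(N : ℝ) + (1 - s)) with hk
  have hgi : Integrable g := (integrable_indicator_iff measurableSet_ball).2
    (h.integrableOn_abs_lastCoord_symm_rpow hN hM' (by linarith) R)
  have hki : Integrable fun h : E N => k ‖h‖ := by
    have h1 := integrableOn_ball_norm_rpow (F := E N) volume (b := 1 - s) (R := 2 * R)
      (by linarith)
    rw [finrank_euclideanSpace_fin, ← integrable_indicator_iff measurableSet_ball] at h1
    refine h1.congr (Eventually.of_forall fun x => ?_)
    simp [hk, indicator]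
  have hdom := ((integrable_fst_mul_norm_sub hgi hki).add
    (integrable_snd_mul_norm_sub hgi hki)).const_mul (M' ^ (s * p + (1 - s)))
  refine Integrable.mono' hdom.integrableOn (aestronglyMeasurable_gagliardo s p
    (h.continuous_pullback hN hs0).aestronglyMeasurable).restrict ?_
  filter_upwards [ae_restrict_mem (measurableSet_ball.prod measurableSet_ball)] with z hz
  have h1 : z.1 ∈ B := hz.1
  have h2 : z.2 ∈ B := hz.2
  have h3 : ‖z.1 - z.2‖ < 2 * R := by
    have h4 : ‖z.1‖ < R := by simpa [hB] using h1
    have h5 : ‖z.2‖ < R := by simpa [hB] using h2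
    linarith [_root_.norm_sub_le z.1 z.2]
  rw [Real.norm_of_nonneg (gagliardo_nonneg _ _ _ _)]
  refine (h.gagliardo_pullback_le hN hM' hs0 hs1 hp z).trans (le_of_eq ?_)
  simp only [Pi.add_apply, hg, hk]
  rw [indicator_of_mem h1, indicator_of_mem h2, indicator_of_mem (by exact h3)]

/-- The function grows at most like |x|^s, so the integrand decays like |x|^(s(p-1)-N-ps) =
|x|^(-N-s). -/
lemma lintegral_tail_pullback_lt_top (h : IsTame Φ r M M' K) (hN : 1 ≤ N) (hM' : 0 < M')
    {s p : ℝ} (hs0 : 0 < s) (hs1 : s < 1) (hp : 1 < p) :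
    ∫⁻ x : E N, ENNReal.ofReal (|pullback hN s Φ x| ^ (p - 1) /
      (1 + ‖x‖) ^ ((N : ℝ) + p * s)) < ∞ := by
  have h1 := integrable_one_add_norm (E := E N) (μ := volume) (r := (N : ℝ) + s)
    (by rw [finrank_euclideanSpace_fin]; linarith)
  set D : ℝ := ‖Φ.symm 0‖ + M' with hD
  have hD0 : 0 ≤ D := by positivity
  refine lt_of_le_of_lt (lintegral_mono fun x => ENNReal.ofReal_le_ofReal ?_)
    (h1.const_mul (D ^ (s * (p - 1)))).lintegral_lt_top
  have hpos : 0 < 1 + ‖x‖ := by positivity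
  have h2 : |lastCoord hN (Φ.symm x)| ≤ D * (1 + ‖x‖) := by
    have h3 : |lastCoord hN (Φ.symm x)| ≤ ‖Φ.symm x‖ := PiLp.norm_apply_le (Φ.symm x) _
    have h4 := h.norm_symm_sub_le x 0
    have h5 := norm_sub_norm_le (Φ.symm x) (Φ.symm 0)
    rw [sub_zero] at h4
    rw [hD]
    nlinarith [norm_nonneg x, norm_nonneg (Φ.symm 0)]
  have h3 : |pullback hN s Φ x| ≤ (D * (1 + ‖x‖)) ^ s := by
    have := abs_posPow_sub_le hs0 hs1 (lastCoord hN (Φ.symm x)) 0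
    rw [posPow_of_nonpos hs0 le_rfl, sub_zero, sub_zero] at this
    exact this.trans (Real.rpow_le_rpow (abs_nonneg _) h2 hs0.le)
  rw [div_le_iff₀ (by positivity)]
  calc _ ≤ ((D * (1 + ‖x‖)) ^ s) ^ (p - 1) := by
        gcongr
    _ = D ^ (s * (p - 1)) * (1 + ‖x‖) ^ (s * (p - 1)) := by
        rw [← Real.rpow_mul (by positivity), Real.mul_rpow hD0 hpos.le]
    _ = _ := by
        rw [mul_assoc, ← Real.rpow_add hpos]
        ring_nf

lemma memWTilde_pullback (h : IsTame Φ r M M' K) (hN : 1 ≤ N) (hM' : 0 < M') {s p : ℝ}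
    (hs0 : 0 < s) (hs1 : s < 1) (hp : 1 < p) {Ω : Set (E N)} (hΩ : Bornology.IsBounded Ω) :
    MemWTilde s p Ω (pullback hN s Φ) := by
  have hc := h.continuous_pullback hN hs0
  have hloc : MemLpLoc p (pullback hN s Φ) := by
    intro S hS
    obtain ⟨C, hC⟩ := hS.exists_bound_of_continuousOn hc.continuousOn
    have : IsFiniteMeasure (volume.restrict S) := ⟨by simpa using hS.measure_lt_top⟩
    refine MemLp.of_bound hc.aestronglyMeasurable C ?_
    filter_upwards [ae_restrict_mem hS.measurableSet] with x hx using hC x hx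
  refine ⟨hloc, ?_⟩
  obtain ⟨R, hR⟩ := hΩ.subset_closedBall 0
  refine ⟨Metric.ball 0 (R + 1), Metric.isOpen_ball, ?_, ?_⟩
  · exact (closure_minimal hR Metric.isClosed_closedBall).trans
      (Metric.closedBall_subset_ball (by linarith))
  refine ENNReal.add_lt_top.2 ⟨ENNReal.add_lt_top.2 ⟨?_, ?_⟩,
    h.lintegral_tail_pullback_lt_top hN hM' hs0 hs1 hp⟩
  · exact ((hloc _ (isCompact_closedBall 0 (R + 1))).mono_measure
      (Measure.restrict_mono Metric.ball_subset_closedBall le_rfl)).eLpNorm_lt_top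
  · refine ENNReal.rpow_lt_top_of_nonneg (by positivity) ?_
    exact (h.integrableOn_gagliardo_pullback hN hM' hs0 hs1 hp (R + 1)).lintegral_lt_top.ne

end IsTame

/-! ### Test functions, duality and convergence of the weak form -/

lemma rpow_sub_one_mul_le_add {p a b : ℝ} (hp : 1 < p) (ha : 0 ≤ a) (hb : 0 ≤ b) :
    a ^ (p - 1) * b ≤ a ^ p + b ^ p := by
  have e : ∀ c : ℝ, 0 ≤ c → c ^ p = c ^ (p - 1) * c := fun c hc => by
    rw [← Real.rpow_add_one' hc (by linarith)]
    ring_nf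
  have ha' := Real.rpow_nonneg ha p
  have hb' := Real.rpow_nonneg hb p
  rcases le_total a b with h | h
  · calc _ ≤ b ^ (p - 1) * b := by gcongr
      _ ≤ _ := by rw [← e b hb]; linarith
  · calc _ ≤ a ^ (p - 1) * a := by gcongr
      _ ≤ _ := by rw [← e a ha]; linarith

namespace MemW0

variable {N : ℕ} {s p : ℝ} {Ω : Set (E N)} {φ : E N → ℝ}

lemma memLp (h : MemW0 s p Ω φ) : MemLp φ (ENNReal.ofReal p) := by
  have h1 := (ENNReal.add_lt_top.1 h.2.1).1
  rw [Measure.restrict_univ] at h1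
  exact ⟨h.1, h1⟩

lemma integrable_gagliardo (h : MemW0 s p Ω φ) (hp : 1 < p) : Integrable (gagliardo s p φ) := by
  have h1 := (ENNReal.add_lt_top.1 h.2.1).2
  rw [ENNReal.rpow_lt_top_iff_of_pos (by positivity), univ_prod_univ, Measure.restrict_univ] at h1
  refine ⟨aestronglyMeasurable_gagliardo s p h.1, ?_⟩
  rwa [hasFiniteIntegral_iff_ofReal (Eventually.of_forall fun z => gagliardo_nonneg _ _ _ _)]

lemma integrableOn (h : MemW0 s p Ω φ) (hp : 1 < p) {S : Set (E N)}
    (hS : Bornology.IsBounded S) : IntegrableOn φ S := by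
  have : IsFiniteMeasure (volume.restrict S) := ⟨by simpa using hS.measure_lt_top⟩
  exact (h.memLp.restrict S).integrable (by rw [← ENNReal.ofReal_one]; gcongr)

lemma integrable (h : MemW0 s p Ω φ) (hp : 1 < p) (hΩ : Bornology.IsBounded Ω) :
    Integrable φ := by
  obtain ⟨R, hR⟩ := hΩ.subset_closedBall 0
  have h1 := h.integrableOn hp (Metric.isBounded_closedBall (x := (0 : E N)) (r := R))
  rw [← integrable_indicator_iff Metric.isClosed_closedBall.measurableSet] at h1
  refine h1.congr ?_
  filter_upwards [h.2.2] with x hx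
  by_cases hxR : x ∈ Metric.closedBall (0 : E N) R
  · rw [indicator_of_mem hxR]
  · rw [indicator_of_notMem hxR, hx fun hxΩ => hxR (hR hxΩ)]

lemma ae_prod (h : MemW0 s p Ω φ) :
    ∀ᵐ z : E N × E N, (z.1 ∉ Ω → φ z.1 = 0) ∧ (z.2 ∉ Ω → φ z.2 = 0) := by
  rw [Measure.volume_eq_prod]
  exact (Measure.quasiMeasurePreserving_fst.ae h.2.2).and
    (Measure.quasiMeasurePreserving_snd.ae h.2.2)

end MemW0

/-- A bounded function defines an element of the dual space on a bounded set. -/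
lemma memDual_of_bounded {N : ℕ} {s p : ℝ} (hp : 1 < p) {Ω : Set (E N)}
    (hΩ : Bornology.IsBounded Ω) {f : E N → ℝ} (hf : Measurable f) {C : ℝ}
    (hC : ∀ x, |f x| ≤ C) : MemDual s p Ω f := by
  have hfin : IsFiniteMeasure (volume.restrict Ω) := ⟨by simpa using hΩ.measure_lt_top⟩
  have hC0 : 0 ≤ C := (abs_nonneg _).trans (hC 0)
  refine ⟨fun φ hφ => ?_, ?_⟩
  · exact (hφ.integrableOn hp hΩ).bdd_mul hf.aestronglyMeasurable
      (Eventually.of_forall fun x => hC x)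
  -- Hölder's inequality on Ω: V is |Ω|^(1-1/p), and the L^p norm is one part of the full norm.
  · set V : ℝ≥0∞ := (volume.restrict Ω) univ ^ (1 / (1 : ℝ≥0∞).toReal -
      1 / (ENNReal.ofReal p).toReal) with hV
    have hVt : V ≠ ∞ := by
      refine ENNReal.rpow_ne_top_of_nonneg ?_ (measure_ne_top _ _)
      rw [ENNReal.toReal_one, ENNReal.toReal_ofReal (by linarith), sub_nonneg]
      exact (div_le_div_iff_of_pos_left one_pos (by linarith) one_pos).2 hp.le
    refine ⟨C.toNNReal * V.toNNReal, fun φ hφ => ?_⟩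
    calc ‖∫ x in Ω, f x * φ x‖ₑ ≤ ∫⁻ x in Ω, ‖f x * φ x‖ₑ := enorm_integral_le_lintegral_enorm _
      _ ≤ ∫⁻ x in Ω, ENNReal.ofReal C * ‖φ x‖ₑ := by
        refine lintegral_mono fun x => ?_
        rw [enorm_mul]
        gcongr
        rw [← ofReal_norm]
        exact ENNReal.ofReal_le_ofReal (hC x)
      _ = ENNReal.ofReal C * eLpNorm φ 1 (volume.restrict Ω) := by
        rw [lintegral_const_mul' _ _ ENNReal.ofReal_ne_top, eLpNorm_one_eq_lintegral_enorm]
      _ ≤ ENNReal.ofReal C * (eLpNorm φ (ENNReal.ofReal p) (volume.restrict Ω) * V) := by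
        gcongr
        exact eLpNorm_le_eLpNorm_mul_rpow_measure_univ (by rw [← ENNReal.ofReal_one]; gcongr)
          hφ.1.restrict
      _ ≤ ENNReal.ofReal C * (wNorm s p univ φ * V) := by
        gcongr
        exact (eLpNorm_mono_measure _ (Measure.restrict_mono (subset_univ _) le_rfl)).trans
          le_self_add
      _ = _ := by
        rw [ENNReal.coe_mul, ENNReal.coe_toNNReal hVt]
        change ENNReal.ofReal C * _ = ENNReal.ofReal C * _ * _
        ring

lemma aestronglyMeasurable_weakForm {N : ℕ} (s p : ℝ) {u φ : E N → ℝ}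
    (hu : AEStronglyMeasurable u volume) (hφ : AEStronglyMeasurable φ volume) :
    AEStronglyMeasurable (weakForm s p u φ) volume := by
  unfold weakForm
  have h1 : AEStronglyMeasurable (fun z : E N × E N => u z.1) volume := hu.comp_fst
  have h2 : AEStronglyMeasurable (fun z : E N × E N => u z.2) volume := hu.comp_snd
  have h3 : AEStronglyMeasurable (fun z : E N × E N => φ z.1) volume := hφ.comp_fst
  have h4 : AEStronglyMeasurable (fun z : E N × E N => φ z.2) volume := hφ.comp_snd
  have h5 := (measurable_spow (p - 1)).comp_aemeasurable (h1.aemeasurable.sub h2.aemeasurable)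
  exact ((h5.mul (h3.aemeasurable.sub h4.aemeasurable)).div
    (by fun_prop : Measurable fun z : E N × E N =>
    ‖z.1 - z.2‖ ^ ((N : ℝ) + p * s)).aemeasurable).aestronglyMeasurable

lemma abs_weakForm {N : ℕ} {s p : ℝ} (hp : 1 < p) (u φ : E N → ℝ) (z : E N × E N) :
    |weakForm s p u φ z| = |u z.1 - u z.2| ^ (p - 1) * |φ z.1 - φ z.2| *
      ‖z.1 - z.2‖ ^ (-(N : ℝ) - p * s) := by
  unfold weakForm
  rw [abs_div, abs_mul, abs_spow (by linarith), div_eq_mul_inv,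
    abs_of_nonneg (by positivity : 0 ≤ ‖z.1 - z.2‖ ^ ((N : ℝ) + p * s)),
    ← Real.rpow_neg (norm_nonneg _), neg_add']

lemma abs_weakForm_le {N : ℕ} {s p : ℝ} (hp : 1 < p) (u φ : E N → ℝ) (z : E N × E N) :
    |weakForm s p u φ z| ≤ gagliardo s p u z + gagliardo s p φ z := by
  unfold weakForm gagliardo
  rw [abs_div, abs_mul, abs_spow (by linarith), ← add_div,
    abs_of_nonneg (by positivity : 0 ≤ ‖z.1 - z.2‖ ^ ((N : ℝ) + p * s))]
  gcongr
  exact rpow_sub_one_mul_le_add hp (abs_nonneg _) (abs_nonneg _)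

/-- Pairs at distance at least 1 are controlled by |φ| against an integrable kernel, because the
increment of v is at most a power of the distance. For closer pairs, Young's inequality bounds the
integrand by the two Gagliardo densities, that of v being needed only on a ball. -/
lemma IsTame.integrable_weakForm {N : ℕ} {Φ : E N ≃ E N} {r M M' K : ℝ}
    (h : IsTame Φ r M M' K) (hN : 1 ≤ N) (hM' : 0 < M') {s p : ℝ} (hs0 : 0 < s) (hs1 : s < 1)
    (hp : 1 < p) {Ω : Set (E N)} (hΩ : Bornology.IsBounded Ω) {φ : E N → ℝ}
    (hφ : MemW0 s p Ω φ) : Integrable (weakForm s p (pullback hN s Φ) φ) := by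
  have := nontrivial_E hN
  obtain ⟨R, hR⟩ := hΩ.subset_ball 0
  set B : Set (E N) := Metric.ball 0 (R + 1) with hB
  set k : ℝ → ℝ := (Ici 1).indicator fun d => d ^ (-(N : ℝ) - s) with hk
  have hk0 : ∀ d, 0 ≤ d → 0 ≤ k d := fun d hd =>
    indicator_apply_nonneg fun _ => Real.rpow_nonneg hd _
  have hki : Integrable fun h : E N => k ‖h‖ := by
    have h1 := integrable_indicator_norm_rpow (F := E N) volume hs0 one_pos
    rw [finrank_euclideanSpace_fin] at h1
    refine h1.congr (Eventually.of_forall fun x => ?_)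
    simp [hk, indicator]
  have hφi := (hφ.integrable hp hΩ).abs
  have hgv := (integrable_indicator_iff (measurableSet_ball.prod measurableSet_ball)).2
    (h.integrableOn_gagliardo_pullback hN hM' hs0 hs1 hp (R + 1))
  have hdom := (hgv.add (hφ.integrable_gagliardo hp)).add
    (((integrable_fst_mul_norm_sub hφi hki).add
      (integrable_snd_mul_norm_sub hφi hki)).const_mul (M' ^ (s * (p - 1))))
  refine Integrable.mono' hdom (aestronglyMeasurable_weakForm s p
    (h.continuous_pullback hN hs0).aestronglyMeasurable hφ.1) ?_
  filter_upwards [hφ.ae_prod] with z hz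
  simp only [Pi.add_apply, Real.norm_eq_abs]
  have hg0 := gagliardo_nonneg s p φ z
  have hk0' := hk0 _ (norm_nonneg (z.1 - z.2))
  have hv0 : 0 ≤ (Metric.ball (0 : E N) (R + 1) ×ˢ Metric.ball (0 : E N) (R + 1)).indicator
      (gagliardo s p (pullback hN s Φ)) z :=
    indicator_apply_nonneg fun _ => gagliardo_nonneg _ _ _ _
  have hM0 : 0 ≤ M' ^ (s * (p - 1)) := by positivity
  rcases le_or_gt 1 ‖z.1 - z.2‖ with hd | hd
  · have hpos : 0 < ‖z.1 - z.2‖ := by linarith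
    have hke : k ‖z.1 - z.2‖ = ‖z.1 - z.2‖ ^ (s * (p - 1)) *
        ‖z.1 - z.2‖ ^ (-(N : ℝ) - p * s) := by
      rw [rpow_mul_rpow_neg hpos, hk, indicator_of_mem (by exact hd)]
    have h1 : |weakForm s p (pullback hN s Φ) φ z| ≤
        M' ^ (s * (p - 1)) * (|φ z.1| * k ‖z.1 - z.2‖ + |φ z.2| * k ‖z.1 - z.2‖) := by
      rw [abs_weakForm hp, hke]
      have h2 : |pullback hN s Φ z.1 - pullback hN s Φ z.2| ^ (p - 1) ≤
          M' ^ (s * (p - 1)) * ‖z.1 - z.2‖ ^ (s * (p - 1)) := by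
        rw [← Real.mul_rpow hM'.le hpos.le, Real.rpow_mul (by positivity)]
        exact Real.rpow_le_rpow (abs_nonneg _) (h.abs_pullback_sub_le hN hs0 hs1 _ _)
          (by linarith)
      calc _ ≤ M' ^ (s * (p - 1)) * ‖z.1 - z.2‖ ^ (s * (p - 1)) * (|φ z.1| + |φ z.2|) *
            ‖z.1 - z.2‖ ^ (-(N : ℝ) - p * s) := by
            gcongr
            exact abs_sub _ _
        _ = _ := by ring
    linarith
  · have h0 : 0 ≤ M' ^ (s * (p - 1)) * (|φ z.1| * k ‖z.1 - z.2‖ + |φ z.2| * k ‖z.1 - z.2‖) := by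
      positivity
    by_cases hmem : z.1 ∈ Ω ∨ z.2 ∈ Ω
    · have hzB : z ∈ B ×ˢ B := by
        rcases hmem with h1 | h1
        · have h2 : ‖z.1‖ < R := by simpa using hR h1
          have h3 := _root_.norm_sub_norm_le z.2 z.1
          rw [norm_sub_rev] at h3
          exact ⟨by simp only [hB, mem_ball_zero_iff]; linarith,
            by simp only [hB, mem_ball_zero_iff]; linarith⟩
        · have h2 : ‖z.2‖ < R := by simpa using hR h1
          have h3 := _root_.norm_sub_norm_le z.1 z.2
          exact ⟨by simp only [hB, mem_ball_zero_iff]; linarith,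
            by simp only [hB, mem_ball_zero_iff]; linarith⟩
      rw [indicator_of_mem hzB]
      linarith [abs_weakForm_le (s := s) hp (pullback hN s Φ) φ z]
    · push Not at hmem
      have : weakForm s p (pullback hN s Φ) φ z = 0 := by
        simp [weakForm, hz.1 hmem.1, hz.2 hmem.2]
      rw [this, abs_zero]
      linarith

/-! ### The fractional Hardy inequality -/

namespace IsTame

variable {N : ℕ} {Φ : E N ≃ E N} {r M M' K : ℝ}

/-- A ball in the complement of the image of the half-space, at a distance from `Φ w` comparable to
the distance of `w` to the boundary. -/
lemma exists_ball_disjoint (h : IsTame Φ r M M' K) (hN : 1 ≤ N) (hM' : 0 < M')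
    {w : E N} (hw : 0 < lastCoord hN w) :
    ∃ c : E N, ∀ y ∈ Metric.ball c (lastCoord hN w / M'), y ∉ Φ '' halfSpace hN ∧
      ‖Φ w - y‖ ≤ (2 * M + 1 / M') * lastCoord hN w := by
  set a := lastCoord hN w with ha
  -- Moving w by 2a across the boundary reaches height -a. The ball of radius a/M' about its image
  -- pulls back into the ball of radius a about w - e, which stays out of the half-space.
  set e : E N := EuclideanSpace.single ⟨N - 1, Nat.sub_one_lt_of_lt hN⟩ (2 * a) with he
  have hea : lastCoord hN e = 2 * a := by simp [lastCoord, he]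
  have hne : ‖e‖ = 2 * a := by
    rw [he, PiLp.norm_single, Real.norm_of_nonneg (by linarith)]
  refine ⟨Φ (w - e), fun y hy => ⟨?_, ?_⟩⟩
  · rintro ⟨z, hz, rfl⟩
    have hz : 0 < lastCoord hN z := hz
    have h1 : ‖Φ z - Φ (w - e)‖ < a / M' := by simpa [dist_eq_norm] using hy
    have h2 := h.le_norm_sub z (w - e)
    have h3 : ‖z - (w - e)‖ < a := by
      rw [lt_div_iff₀' hM'] at h1
      linarith
    have h4 := (abs_lastCoord_sub_le hN z (w - e)).trans_lt h3
    have h5 : lastCoord hN (w - e) = a - 2 * a := by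
      rw [← hea, ha]
      rfl
    rw [h5] at h4
    linarith [(abs_lt.1 h4).2]
  · have h1 : ‖Φ (w - e) - y‖ < a / M' := by
      rw [norm_sub_rev]
      simpa [dist_eq_norm] using hy
    have h2 := h.norm_sub_le w (w - e)
    rw [sub_sub_cancel, hne] at h2
    calc ‖Φ w - y‖ ≤ ‖Φ w - Φ (w - e)‖ + ‖Φ (w - e) - y‖ := norm_sub_le_norm_sub_add_norm_sub _ _ _
      _ ≤ M * (2 * a) + a / M' := by gcongr
      _ = _ := by ring

/-- The fractional Hardy inequality for functions that vanish outside the domain. -/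
lemma integrable_abs_rpow_mul_lastCoord_rpow (h : IsTame Φ r M M' K) (hN : 1 ≤ N) (hM : 0 < M)
    (hM' : 0 < M') {s p : ℝ} (hs0 : 0 < s) (hp : 1 < p) {Ω : Set (E N)}
    (hΩH : Ω ⊆ Φ '' halfSpace hN) {φ : E N → ℝ} (hφ : MemW0 s p Ω φ) :
    Integrable fun x => |φ x| ^ p * |lastCoord hN (Φ.symm x)| ^ (-(p * s)) := by
  have := nontrivial_E hN
  have hmeas : AEMeasurable (fun x => |φ x| ^ p * |lastCoord hN (Φ.symm x)| ^ (-(p * s))) :=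
    (hφ.1.aemeasurable.abs.pow_const p).mul
      ((h.continuous_lastCoord_symm hN).measurable.abs.pow_const _).aemeasurable
  refine ⟨hmeas.aestronglyMeasurable, ?_⟩
  rw [hasFiniteIntegral_iff_ofReal (Eventually.of_forall fun x => by positivity)]
  set D : ℝ := 2 * M + 1 / M' with hD
  have hD0 : 0 < D := by positivity
  set c : ℝ≥0∞ := ENNReal.ofReal (D ^ (-((N : ℝ) + p * s)) * M'⁻¹ ^ N) *
    volume (Metric.ball (0 : E N) 1) with hc
  have hvol0 : volume (Metric.ball (0 : E N) 1) ≠ 0 := (Metric.measure_ball_pos _ _ one_pos).ne'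
  have hc0 : c ≠ 0 := mul_ne_zero (by
    rw [Ne, ENNReal.ofReal_eq_zero, not_le]
    positivity) hvol0
  have hct : c ≠ ∞ := ENNReal.mul_ne_top ENNReal.ofReal_ne_top measure_ball_lt_top.ne
  have hgag := (hφ.integrable_gagliardo hp).lintegral_lt_top
  rw [Measure.volume_eq_prod, lintegral_prod _ (by
    have := (aestronglyMeasurable_gagliardo s p hφ.1).aemeasurable
    rw [Measure.volume_eq_prod] at this
    exact this.ennreal_ofReal)] at hgag
  -- Keeping only the y in the exterior ball, where φ(y) = 0 and |x - y| ≤ D a, the inner Gagliardo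
  -- integral is at least |φ(x)|^p (D a)^(-N-ps) times a volume of order a^N.
  have key : ∀ᵐ x, c * ENNReal.ofReal (|φ x| ^ p * |lastCoord hN (Φ.symm x)| ^ (-(p * s))) ≤
      ∫⁻ y, ENNReal.ofReal (gagliardo s p φ (x, y)) := by
    filter_upwards [hφ.2.2] with x hx
    by_cases hxΩ : x ∈ Ω
    swap
    · simp [hx hxΩ, Real.zero_rpow (show p ≠ 0 by linarith)]
    obtain ⟨w, hw, rfl⟩ := hΩH hxΩ
    have hw : 0 < lastCoord hN w := hw
    simp only [Φ.symm_apply_apply]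
    set a := lastCoord hN w with ha
    obtain ⟨y0, hy0⟩ := h.exists_ball_disjoint hN hM' hw
    have hlow : ∀ᵐ y, y ∈ Metric.ball y0 (a / M') →
        ENNReal.ofReal (|φ (Φ w)| ^ p * (D * a) ^ (-((N : ℝ) + p * s))) ≤
          ENNReal.ofReal (gagliardo s p φ (Φ w, y)) := by
      filter_upwards [hφ.2.2] with y hy hyb
      obtain ⟨h1, h2⟩ := hy0 y hyb
      have hφy := hy fun h' => h1 (hΩH h')
      have hne : Φ w ≠ y := fun h' => h1 (h' ▸ ⟨w, hw, rfl⟩)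
      have hpos : 0 < ‖Φ w - y‖ := norm_pos_iff.2 (sub_ne_zero.2 hne)
      refine ENNReal.ofReal_le_ofReal ?_
      simp only [gagliardo, hφy, sub_zero]
      rw [div_eq_mul_inv, ← Real.rpow_neg (norm_nonneg _)]
      refine mul_le_mul_of_nonneg_left (Real.rpow_le_rpow_of_nonpos hpos h2 ?_) (by positivity)
      have : (0 : ℝ) ≤ N := Nat.cast_nonneg _
      have : 0 < p * s := by positivity
      linarith
    calc c * ENNReal.ofReal (|φ (Φ w)| ^ p * |a| ^ (-(p * s))) =
          ENNReal.ofReal (|φ (Φ w)| ^ p * (D * a) ^ (-((N : ℝ) + p * s))) *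
            volume (Metric.ball y0 (a / M')) := by
          rw [Measure.addHaar_ball _ _ (by positivity), finrank_euclideanSpace_fin, hc,
            mul_right_comm, ← mul_assoc, ← ENNReal.ofReal_mul (by positivity),
            ← ENNReal.ofReal_mul (by positivity)]
          congr 2
          rw [abs_of_pos hw, Real.mul_rpow hD0.le hw.le, div_eq_mul_inv, mul_pow]
          have : a ^ (-(p * s)) = a ^ (-((N : ℝ) + p * s)) * a ^ N := by
            rw [← Real.rpow_natCast, ← Real.rpow_add hw]
            ring_nf
          rw [this]
          ring
      _ = ∫⁻ y in Metric.ball y0 (a / M'),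
          ENNReal.ofReal (|φ (Φ w)| ^ p * (D * a) ^ (-((N : ℝ) + p * s))) := by
          rw [setLIntegral_const]
      _ ≤ ∫⁻ y in Metric.ball y0 (a / M'), ENNReal.ofReal (gagliardo s p φ (Φ w, y)) :=
          lintegral_mono_ae ((ae_restrict_iff' measurableSet_ball).2 hlow)
      _ ≤ _ := setLIntegral_le_lintegral _ _
  have hfin := (lintegral_mono_ae key).trans_lt hgag
  rw [lintegral_const_mul' _ _ hct] at hfin
  exact (ENNReal.mul_lt_top_iff.1 hfin).elim (fun h' => h'.2) fun h' => h'.elim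
    (fun h0 => absurd h0 hc0) fun h0 => by rw [h0]; exact ENNReal.zero_lt_top

/-- On the bounded set Ω the quantity is at most 1 plus its p-th power, which Hardy's inequality
controls. -/
lemma integrable_abs_mul_lastCoord_rpow (h : IsTame Φ r M M' K) (hN : 1 ≤ N) (hM : 0 < M)
    (hM' : 0 < M') {s p : ℝ} (hs0 : 0 < s) (hp : 1 < p) {Ω : Set (E N)}
    (hΩ : Bornology.IsBounded Ω)
    (hΩH : Ω ⊆ Φ '' halfSpace hN) {φ : E N → ℝ} (hφ : MemW0 s p Ω φ) :
    Integrable fun x => |φ x| * |lastCoord hN (Φ.symm x)| ^ (-s) := by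
  obtain ⟨R, hR⟩ := hΩ.subset_ball 0
  have h1 := h.integrable_abs_rpow_mul_lastCoord_rpow hN hM hM' hs0 hp hΩH hφ
  have h2 : Integrable ((Metric.ball (0 : E N) R).indicator fun _ => (1 : ℝ)) :=
    (integrable_indicator_iff measurableSet_ball).2 (integrableOn_const measure_ball_lt_top.ne)
  refine (h1.add h2).mono' ((hφ.1.aemeasurable.abs.mul
    ((h.continuous_lastCoord_symm hN).measurable.abs.pow_const _).aemeasurable).aestronglyMeasurable)
    ?_
  filter_upwards [hφ.2.2] with x hx
  by_cases hxΩ : x ∈ Ω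
  · rw [Real.norm_of_nonneg (by positivity), Pi.add_apply, indicator_of_mem (hR hxΩ)]
    have h3 := rpow_sub_one_mul_le_add hp
      (by positivity : 0 ≤ |φ x| * |lastCoord hN (Φ.symm x)| ^ (-s)) zero_le_one
    have h4 : (|φ x| * |lastCoord hN (Φ.symm x)| ^ (-s)) ^ p =
        |φ x| ^ p * |lastCoord hN (Φ.symm x)| ^ (-(p * s)) := by
      rw [Real.mul_rpow (abs_nonneg _) (by positivity), ← Real.rpow_mul (abs_nonneg _)]
      ring_nf
    rw [← h4]
    set t := |φ x| * |lastCoord hN (Φ.symm x)| ^ (-s)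
    have ht : 0 ≤ t := by positivity
    rcases le_total t 1 with h5 | h5
    · have := Real.rpow_nonneg ht p
      linarith
    · have := Real.rpow_le_rpow_of_exponent_le h5 hp.le
      rw [Real.rpow_one] at this
      linarith
  · rw [hx hxΩ]
    simp only [abs_zero, zero_mul, norm_zero, Pi.add_apply]
    exact add_nonneg (by positivity) (indicator_apply_nonneg fun _ => zero_le_one)

end IsTame

/-! ### Removing the truncation in the weak formulation -/

lemma truncInt_symm (s p l a b : ℝ) : truncInt s p l b a = -truncInt s p l a b := by
  unfold truncInt
  by_cases h : offDiag l a b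
  · rw [indicator_of_mem (show a ∈ {c | offDiag l b c} from offDiag_symm.1 h),
      indicator_of_mem (show b ∈ {c | offDiag l a c} from h), ← spow_neg, neg_sub]
  · rw [indicator_of_notMem (show a ∉ {c | offDiag l b c} from fun h' => h (offDiag_symm.1 h')),
      indicator_of_notMem (show b ∉ {c | offDiag l a c} from h), neg_zero]

lemma abs_truncInt_le_abs_spow (s p l a b : ℝ) :
    |truncInt s p l a b| ≤ |spow (posPow s a - posPow s b) (p - 1)| := by
  unfold truncInt indicator
  split_ifs
  · exact le_rfl
  · rw [abs_zero]
    exact abs_nonneg _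

lemma measurable_truncInt_uncurry {s : ℝ} (hs : 0 < s) (p l : ℝ) :
    Measurable fun q : ℝ × ℝ => truncInt s p l q.1 q.2 := by
  have hm : MeasurableSet {q : ℝ × ℝ | offDiag l q.1 q.2} := by
    unfold offDiag
    exact (measurableSet_le measurable_snd (measurable_fst.const_mul l)).union
      (measurableSet_le measurable_fst (measurable_snd.const_mul l))
  have hc := (continuous_posPow hs.le).measurable
  have h1 : Measurable fun q : ℝ × ℝ => spow (posPow s q.1 - posPow s q.2) (p - 1) :=
    (measurable_spow _).comp ((hc.comp measurable_fst).sub (hc.comp measurable_snd))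
  exact h1.indicator hm

lemma MemW0.ae_lastCoord_symm_pos {N : ℕ} {Φ : E N ≃ E N} (hN : 1 ≤ N) {s p : ℝ} {Ω : Set (E N)}
    (hΩH : Ω ⊆ Φ '' halfSpace hN) {φ : E N → ℝ} (hφ : MemW0 s p Ω φ) :
    ∀ᵐ x, φ x ≠ 0 → 0 < lastCoord hN (Φ.symm x) := by
  filter_upwards [hφ.2.2] with x hx hne
  have hxΩ : x ∈ Ω := by
    by_contra h'
    exact hne (hx h')
  obtain ⟨w, hw, rfl⟩ := hΩH hxΩ
  rw [Φ.symm_apply_apply]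
  exact hw

namespace IsTame

variable {N : ℕ} {Φ : E N ≃ E N} {r M M' K : ℝ}

lemma measurable_residual (h : IsTame Φ r M M' K) (hN : 1 ≤ N) {s : ℝ} (hs0 : 0 < s) (p : ℝ) :
    Measurable (residual hN s p Φ) := by
  have hc := (continuous_posPow hs0.le).measurable.comp (continuous_lastCoord hN).measurable
  have h1 : Measurable fun q : E N × E N => spow (posPow s (lastCoord hN q.1) -
      posPow s (lastCoord hN q.2)) (p - 1) * kernelDiff (p * s) Φ q.1 q.2 :=
    ((measurable_spow _).comp ((hc.comp measurable_fst).sub (hc.comp measurable_snd))).mul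
      (measurable_kernelDiff h _)
  exact h1.stronglyMeasurable.integral_prod_right.measurable

lemma measurable_truncInt_symm (h : IsTame Φ r M M' K) (hN : 1 ≤ N) {s : ℝ} (hs0 : 0 < s)
    (p l : ℝ) : Measurable fun z : E N × E N =>
      truncInt s p l (lastCoord hN (Φ.symm z.1)) (lastCoord hN (Φ.symm z.2)) := by
  have hc := (h.continuous_lastCoord_symm hN).measurable
  exact (measurable_truncInt_uncurry hs0 p l).comp
    ((hc.comp measurable_fst).prodMk (hc.comp measurable_snd))

/-- Allows Fubini after the two halves of the weak form are separated. For fixed l, the slice over x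
has mass at most a constant times a^(-s), integrable against |φ|. The constant may depend on l,
since no limit is taken here. -/
lemma integrable_truncated (h : IsTame Φ r M M' K) (hN : 1 ≤ N) (hM : 0 < M) (hM' : 0 < M')
    {s p : ℝ} (hs0 : 0 < s) (hs1 : s < 1) (hp : 1 < p) {Ω : Set (E N)}
    (hΩ : Bornology.IsBounded Ω) (hΩH : Ω ⊆ Φ '' halfSpace hN) {φ : E N → ℝ}
    (hφ : MemW0 s p Ω φ) {l : ℝ} (hl : l ∈ Ioo (0 : ℝ) 1) :
    Integrable fun z : E N × E N => φ z.1 *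
      (truncInt s p l (lastCoord hN (Φ.symm z.1)) (lastCoord hN (Φ.symm z.2)) *
        ‖z.1 - z.2‖ ^ (-(N : ℝ) - p * s)) := by
  have := nontrivial_E hN
  have hmeas : AEStronglyMeasurable (fun z : E N × E N => φ z.1 *
      (truncInt s p l (lastCoord hN (Φ.symm z.1)) (lastCoord hN (Φ.symm z.2)) *
        ‖z.1 - z.2‖ ^ (-(N : ℝ) - p * s))) volume :=
    (hφ.1.comp_fst).mul ((h.measurable_truncInt_symm hN hs0 p l).mul
      (by fun_prop)).aestronglyMeasurable
  set J : ℝ := ∫ h : E N, {h : E N | 1 ≤ ‖h‖}.indicator (fun h => ‖h‖ ^ (-(N : ℝ) - s)) h with hJ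
  -- a majorant on each slice
  have hslice : ∀ x : E N, 0 < lastCoord hN (Φ.symm x) → ∃ k : E N → ℝ, Integrable k ∧
      (∀ y, ‖truncInt s p l (lastCoord hN (Φ.symm x)) (lastCoord hN (Φ.symm y)) *
        ‖x - y‖ ^ (-(N : ℝ) - p * s)‖ ≤ k y) ∧
      ∫ y, k y = M' ^ (s * (p - 1)) * ((1 - l) / M') ^ (-s) * J *
        lastCoord hN (Φ.symm x) ^ (-s) := by
    intro x hx
    set a := lastCoord hN (Φ.symm x) with ha
    set R := (1 - l) / M' * a with hR
    have hR0 : 0 < R := mul_pos (div_pos (by linarith [hl.2]) hM') hx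
    have h1 := integrable_indicator_norm_rpow (F := E N) volume hs0 hR0
    have h2 := integral_indicator_norm_rpow (F := E N) (s := s) volume hR0
    rw [finrank_euclideanSpace_fin] at h1 h2
    refine ⟨fun y => M' ^ (s * (p - 1)) *
      {h : E N | R ≤ ‖h‖}.indicator (fun h => ‖h‖ ^ (-(N : ℝ) - s)) (x - y),
      (h1.comp_sub_left x).const_mul _, fun y => ?_, ?_⟩
    · by_cases ho : offDiag l a (lastCoord hN (Φ.symm y))
      · have h3 := ho.le_abs_sub hl.1 hl.2 hx
        have h4 := h.abs_lastCoord_symm_sub_le hN x y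
        have h5 : R ≤ ‖x - y‖ := by
          rw [hR, div_mul_eq_mul_div, div_le_iff₀' hM']
          exact h3.trans h4
        have hpos : 0 < ‖x - y‖ := hR0.trans_le h5
        simp only
        rw [indicator_of_mem (by exact h5), norm_mul, Real.norm_eq_abs,
          Real.norm_of_nonneg (by positivity), ← rpow_mul_rpow_neg (N := N) (s := s) (p := p) hpos,
          ← mul_assoc, ← Real.mul_rpow hM'.le hpos.le]
        gcongr
        refine (abs_truncInt_le hs0 hs1 hp l _ _).trans ?_
        exact Real.rpow_le_rpow (abs_nonneg _) h4 (mul_nonneg hs0.le (by linarith))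
      · rw [truncInt, indicator_of_notMem (by exact ho), zero_mul, norm_zero]
        exact mul_nonneg (by positivity) (indicator_apply_nonneg fun _ => by positivity)
    · rw [integral_const_mul, integral_sub_left_eq_self (fun h : E N =>
        {h : E N | R ≤ ‖h‖}.indicator (fun h => ‖h‖ ^ (-(N : ℝ) - s)) h) volume x, h2, ← hJ, hR,
        Real.mul_rpow (div_nonneg (by linarith [hl.2]) hM'.le) hx.le]
      ring
  have hpos : ∀ᵐ x, φ x ≠ 0 → 0 < lastCoord hN (Φ.symm x) :=
    hφ.ae_lastCoord_symm_pos hN hΩH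
  rw [Measure.volume_eq_prod] at hmeas ⊢
  rw [integrable_prod_iff hmeas]
  refine ⟨?_, ?_⟩
  · filter_upwards [hpos] with x hx
    by_cases hx0 : φ x = 0
    · simp [hx0]
    · obtain ⟨k, hk, hkb, -⟩ := hslice x (hx hx0)
      refine Integrable.const_mul (hk.mono' ?_ (Eventually.of_forall hkb)) _
      exact (((h.measurable_truncInt_symm hN hs0 p l).comp measurable_prodMk_left).mul
        (by fun_prop)).aestronglyMeasurable
  · have hH := (h.integrable_abs_mul_lastCoord_rpow hN hM hM' hs0 hp hΩ hΩH hφ).const_mul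
      (M' ^ (s * (p - 1)) * ((1 - l) / M') ^ (-s) * J)
    refine hH.mono' hmeas.norm.integral_prod_right' ?_
    filter_upwards [hpos] with x hx
    rw [Real.norm_of_nonneg (integral_nonneg fun y => norm_nonneg _)]
    by_cases hx0 : φ x = 0
    · simp [hx0]
    · obtain ⟨k, hk, hkb, hki⟩ := hslice x (hx hx0)
      rw [abs_of_pos (hx hx0)]
      simp only [norm_mul (φ x)]
      rw [integral_const_mul, Real.norm_eq_abs]
      have h6 := integral_mono_of_nonneg (Eventually.of_forall fun y => norm_nonneg _) hk
        (Eventually.of_forall hkb)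
      rw [hki] at h6
      calc _ ≤ |φ x| * _ := mul_le_mul_of_nonneg_left h6 (abs_nonneg _)
        _ = _ := by ring

/-- The weak formulation against a function of `W^{s,p}_0`. -/
lemma integral_weakForm (h : IsTame Φ r M M' K) (hN : 1 ≤ N) (hr : 0 < r) (hM : 0 < M)
    (hM' : 0 < M') (hK : 0 ≤ K) {s p : ℝ} (hs0 : 0 < s) (hs1 : s < 1) (hp : 1 < p)
    {Ω : Set (E N)} (hΩ : Bornology.IsBounded Ω) (hΩH : Ω ⊆ Φ '' halfSpace hN) {φ : E N → ℝ}
    (hφ : MemW0 s p Ω φ) :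
    ∫ z, weakForm s p (pullback hN s Φ) φ z = ∫ x in Ω, (2 * residual hN s p Φ (Φ.symm x)) * φ x := by
  have hweak := h.integrable_weakForm hN hM' hs0 hs1 hp hΩ hφ
  obtain ⟨C₁, C₂, hC₁, hC₂, hC⟩ := exists_truncOp_bounds hN hs0 hs1 hp (M := M) hr hM'
  obtain ⟨-, hbd, hlim⟩ := hC Φ K hK h
  have hmem : ∀ᶠ l : ℝ in 𝓝[<] 1, l ∈ Ioo (0 : ℝ) 1 := Ioo_mem_nhdsLT one_pos
  set a : E N → ℝ := fun x => lastCoord hN (Φ.symm x) with ha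
  set T : ℝ → E N × E N → ℝ := fun l z => truncInt s p l (a z.1) (a z.2) *
    (φ z.1 - φ z.2) / ‖z.1 - z.2‖ ^ ((N : ℝ) + p * s) with hT
  have hTle : ∀ l z, ‖T l z‖ ≤ ‖weakForm s p (pullback hN s Φ) φ z‖ := by
    intro l z
    simp only [hT, weakForm, norm_div, norm_mul]
    gcongr
    exact abs_truncInt_le_abs_spow s p l _ _
  have hTm : ∀ l, AEStronglyMeasurable (T l) volume := fun l => by
    have h3 : AEStronglyMeasurable (fun z : E N × E N => φ z.1) volume := hφ.1.comp_fst
    have h4 : AEStronglyMeasurable (fun z : E N × E N => φ z.2) volume := hφ.1.comp_snd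
    exact (((h.measurable_truncInt_symm hN hs0 p l).aemeasurable.mul
      (h3.aemeasurable.sub h4.aemeasurable)).div (by fun_prop : Measurable fun z : E N × E N =>
        ‖z.1 - z.2‖ ^ ((N : ℝ) + p * s)).aemeasurable).aestronglyMeasurable
  have hTlim : Tendsto (fun l => ∫ z, T l z) (𝓝[<] 1)
      (𝓝 (∫ z, weakForm s p (pullback hN s Φ) φ z)) := by
    refine tendsto_integral_filter_of_dominated_convergence _ (Eventually.of_forall hTm)
      (Eventually.of_forall fun l => Eventually.of_forall (hTle l)) hweak.norm
      (Eventually.of_forall fun z => tendsto_const_nhds.congr' ?_)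
    filter_upwards [eventually_truncInt_eq s p (a z.1) (a z.2)] with l hl
    simp only [hT, hl]
    rfl
  have hTint : ∀ l ∈ Ioo (0 : ℝ) 1, ∫ z, T l z = ∫ x, φ x * (2 * truncOp hN s p l Φ x) := by
    intro l hl
    have hg := h.integrable_truncated hN hM hM' hs0 hs1 hp hΩ hΩH hφ hl
    set g : E N × E N → ℝ := fun z => φ z.1 * (truncInt s p l (lastCoord hN (Φ.symm z.1))
      (lastCoord hN (Φ.symm z.2)) * ‖z.1 - z.2‖ ^ (-(N : ℝ) - p * s)) with hgdef
    -- By antisymmetry of the truncated increment, the φ(y) term is the φ(x) term with the variables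
    -- swapped; this is the source of the factor 2.
    have hsplit : ∀ z, T l z = g z + g z.swap := by
      intro z
      simp only [hT, hgdef, Prod.fst_swap, Prod.snd_swap, ha]
      rw [truncInt_symm s p l (lastCoord hN (Φ.symm z.1)), norm_sub_rev z.2 z.1, div_eq_mul_inv,
        ← Real.rpow_neg (norm_nonneg _), neg_add']
      ring
    rw [Measure.volume_eq_prod] at hg ⊢
    simp_rw [hsplit]
    have hadd := integral_add hg hg.swap
    simp only [Function.comp_apply] at hadd
    rw [hadd, integral_prod_swap g, integral_prod g hg, ← two_mul,
      ← integral_const_mul]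
    refine integral_congr_ae (Eventually.of_forall fun x => ?_)
    simp only [hgdef]
    rw [integral_const_mul, truncOp]
    ring
  have hpos : ∀ᵐ x, φ x ≠ 0 → 0 < a x :=
    hφ.ae_lastCoord_symm_pos hN hΩH
  have hlim2 : Tendsto (fun l => ∫ x, φ x * (2 * truncOp hN s p l Φ x)) (𝓝[<] 1)
      (𝓝 (∫ x, φ x * (2 * residual hN s p Φ (Φ.symm x)))) := by
    -- This majorant is uniform in l: the kernel error gives C₁ K and the frozen part C₂ a^(-s).
    have hdom := ((hφ.integrable hp hΩ).abs.const_mul (2 * (C₁ * K))).add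
      ((h.integrable_abs_mul_lastCoord_rpow hN hM hM' hs0 hp hΩ hΩH hφ).const_mul (2 * C₂))
    refine tendsto_integral_filter_of_dominated_convergence _ ?_ ?_ hdom ?_
    · filter_upwards [hmem] with l hl
      have hg := h.integrable_truncated hN hM hM' hs0 hs1 hp hΩ hΩH hφ hl
      rw [Measure.volume_eq_prod] at hg
      refine (hg.integral_prod_left.const_mul 2).aestronglyMeasurable.congr
        (Eventually.of_forall fun x => ?_)
      simp only
      rw [integral_const_mul, truncOp]
      ring
    · filter_upwards [hmem] with l hl
      filter_upwards [hpos] with x hx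
      by_cases hx0 : φ x = 0
      · simp [hx0]
      · have h1 := hbd (Φ.symm x) (hx hx0) l hl
        rw [Φ.apply_symm_apply] at h1
        rw [norm_mul, norm_mul, Real.norm_two, Real.norm_eq_abs, Real.norm_eq_abs, Pi.add_apply,
          abs_of_pos (hx hx0 : 0 < lastCoord hN (Φ.symm x))]
        calc _ ≤ |φ x| * (2 * (C₁ * K + C₂ * lastCoord hN (Φ.symm x) ^ (-s))) := by gcongr
          _ = _ := by ring
    · filter_upwards [hpos] with x hx
      by_cases hx0 : φ x = 0
      · simp [hx0]
      · have h1 := hlim (Φ.symm x) (hx hx0)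
        rw [Φ.apply_symm_apply] at h1
        exact (h1.const_mul 2).const_mul _
  have huniq := tendsto_nhds_unique (hTlim.congr' (by
    filter_upwards [hmem] with l hl using hTint l hl)) hlim2
  rw [huniq, setIntegral_eq_integral_of_ae_compl_eq_zero]
  · exact integral_congr_ae (Eventually.of_forall fun x => mul_comm _ _)
  · filter_upwards [hφ.2.2] with x hx hxΩ
    rw [hx hxΩ, mul_zero]

lemma isWeakSolBounded_pullback (h : IsTame Φ r M M' K) (hN : 1 ≤ N) (hr : 0 < r) (hM : 0 < M)
    (hM' : 0 < M') (hK : 0 ≤ K) {s p : ℝ} (hs0 : 0 < s) (hs1 : s < 1) (hp : 1 < p)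
    {Ω : Set (E N)} (hΩ : Bornology.IsBounded Ω) (hΩH : Ω ⊆ Φ '' halfSpace hN) :
    IsWeakSolBounded s p Ω (pullback hN s Φ) fun x => 2 * residual hN s p Φ (Φ.symm x) := by
  obtain ⟨C₁, C₂, hC₁, hC₂, hC⟩ := exists_truncOp_bounds hN hs0 hs1 hp (M := M) hr hM'
  refine ⟨h.memWTilde_pullback hN hM' hs0 hs1 hp hΩ, memDual_of_bounded hp hΩ
    (((h.measurable_residual hN hs0 p).comp h.continuous_symm.measurable).const_mul 2)
    (C := 2 * (C₁ * K)) fun x => ?_, fun φ hφ => ⟨h.integrable_weakForm hN hM' hs0 hs1 hp hΩ hφ,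
      h.integral_weakForm hN hr hM hM' hK hs0 hs1 hp hΩ hΩH hφ⟩⟩
  rw [abs_mul, abs_two]
  gcongr
  exact (hC Φ K hK h).1 _

end IsTame

end FracPLap

/-! ### Conclusion -/

theorem lemma3p4 {N : ℕ} (hN : 1 ≤ N) {s p : ℝ} (hs0 : 0 < s) (hs1 : s < 1) (hp : 1 < p)
    (M M' : ℝ≥0) {r : ℝ} (hr : 0 < r) :
    ∃ C : ℝ≥0, ∀ Φ : FracPLap.E N ≃ FracPLap.E N,
      FracPLap.IsC11Diffeo Φ →
      (∀ x, x ∉ Metric.ball 0 r → Φ x = x) →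
      FracPLap.supD Φ ≤ M → FracPLap.supD Φ.symm ≤ M' →
      FracPLap.MemWTildeLoc s p Set.univ
          (fun x => (max (FracPLap.lastCoord hN (Φ.symm x)) 0) ^ s) ∧
        ∃ f : FracPLap.E N → ℝ,
          MemLp f ∞ (volume.restrict (Φ '' FracPLap.halfSpace hN)) ∧
          FracPLap.IsWeakSol s p (Φ '' FracPLap.halfSpace hN)
            (fun x => (max (FracPLap.lastCoord hN (Φ.symm x)) 0) ^ s) f ∧
          eLpNorm f ∞ (volume.restrict (Φ '' FracPLap.halfSpace hN)) ≤
            C * FracPLap.supD2 Φ := by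
  have hM1 : (0 : ℝ) < M + 1 := by positivity
  have hM1' : (0 : ℝ) < M' + 1 := by positivity
  obtain ⟨C₁, C₂, hC₁, hC₂, hC⟩ :=
    FracPLap.exists_truncOp_bounds hN hs0 hs1 hp (M := M + 1) hr hM1'
  -- Only the residual constant C₁ enters, doubled by the symmetrization; C₂ served the domination
  -- alone.
  refine ⟨(2 * C₁).toNNReal, fun Φ hΦ hfix hM hM' => ?_⟩
  obtain ⟨htop, h⟩ := FracPLap.isTame_of_supD_le hN hr hΦ hfix hM hM'
  have hK : 0 ≤ (FracPLap.supD2 Φ).toReal := ENNReal.toReal_nonneg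
  have hloc : ∀ Ω : Set (FracPLap.E N),
      FracPLap.MemWTildeLoc s p Ω (FracPLap.pullback hN s Φ) := fun Ω =>
    ⟨(h.memWTilde_pullback hN hM1' hs0 hs1 hp Bornology.isBounded_empty).1, fun Ω' hΩ' _ =>
      h.memWTilde_pullback hN hM1' hs0 hs1 hp hΩ'⟩
  have hbound : eLpNorm (fun x => 2 * FracPLap.residual hN s p Φ (Φ.symm x)) ∞
      (volume.restrict (Φ '' FracPLap.halfSpace hN)) ≤
        (2 * C₁).toNNReal * FracPLap.supD2 Φ := by
    rw [eLpNorm_exponent_top]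
    refine (eLpNormEssSup_le_of_ae_bound (C := 2 * C₁ * (FracPLap.supD2 Φ).toReal)
      (Filter.Eventually.of_forall fun x => ?_)).trans (le_of_eq ?_)
    · rw [norm_mul, Real.norm_two, mul_assoc]
      gcongr
      exact (hC Φ _ hK h).1 _
    · rw [ENNReal.ofReal_mul (by positivity), ENNReal.ofReal_toReal htop]
      rfl
  refine ⟨hloc _, fun x => 2 * FracPLap.residual hN s p Φ (Φ.symm x), ⟨?_, ?_⟩, ⟨hloc _, ?_⟩,
    hbound⟩
  · exact (((h.measurable_residual hN hs0 p).comp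
      h.continuous_symm.measurable).const_mul 2).aestronglyMeasurable
  · exact hbound.trans_lt (ENNReal.mul_lt_top ENNReal.coe_lt_top htop.lt_top)
  · exact fun Ω' _ hb hsub => h.isWeakSolBounded_pullback hN hr hM1 hM1' hK hs0 hs1 hp hb hsub
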